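/- **Theorem (Absence of run-time errors).** Consider the internal language of Gradual GV. *Types.* Multiplicities are $m,n\in\{\mathsf{lin},\mathsf{un}\}$ with $\mathsf{un}\sqsubseteq\mathsf{un}\sqsubseteq\mathsf{lin}\sqsubseteq\mathsf{lin}$. Types are $T,U ::= 1 \mid S \mid T\to_m U \mid T\times_m U \mid \star$ and session types are $S,R ::= {!}T.S \mid {?}T.S \mid \oplus\{l_i:S_i\}_{i\in I} \mid \&\{l_i:S_i\}_{i\in I} \mid \mathsf{end}_! \mid \mathsf{end}_? \mid \circledast$ ($I$ finite, non-empty), where $\star$ and $\circledast$ are the dynamic type and the dynamic session type. $1$ and $\star$ are unrestricted, session types are linear, $T\to_m U$ and $T\times_m U$ have multiplicity $m$. Duality exchanges $!$ and $?$, $\oplus$ and $\&$, $\mathsf{end}_!$ and $\mathsf{end}_?$, and fixes $\circledast$. Subtyping $<:$ is contravariant in the domain of functions and in the payload of $!$, covariant elsewhere, covariant in multiplicities, with width subtyping removing labels from $\oplus$ and adding labels to $\&$. Consistent subtyping $\lesssim$ has the same rules and also $\star\lesssim T$, $T\lesssim\star$, $\circledast\lesssim S$, $S\lesssim\circledast$.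 A type is *well formed* if every pair type $T\times_{\mathsf{un}}U$ that occurs in it, at any depth, has unrestricted components $T$ and $U$. *Programs.* Names are variables $x$, channel endpoints $c,d$ and references $a$. Expressions are names, $()$, $\lambda_m x.e$, $e\,f$, $(e,f)_m$, $\mathsf{let}\ x,y=e\ \mathsf{in}\ f$, $\mathsf{fork}\ e$, $\mathsf{new}$, $\mathsf{send}\ e\ f$, $\mathsf{receive}\ e$, $\mathsf{select}\ l\ e$, $\mathsf{case}\ e\ \mathsf{of}\ \{l_i:x_i.e_i\}_{i\in I}$, $\mathsf{close}\ e$, $\mathsf{wait}\ e$, and casts $e:T\Rightarrow^p U$ with a blame label $p$. Processes are threads $\langle e\rangle$, $P\mid Q$, $(\nu c,d)P$, $(\nu a)P$, stores $a\mapsto w:G\Rightarrow^p\star$ ($w$ a value, $G$ a ground type) and $a\mapsto\mathsf{locked}\,p$, and blame $\mathsf{blame}\,p\,q\,X$ and $\mathsf{blame}\,p\,X$ ($X$ a finite set of names). Write $\Gamma\vdash e:T$ and $\Gamma\vdash P$ for the linear typing judgements (with subsumption along $<:$; a cast $e:T\Rightarrow^p U$ requires $T\lesssim U$; blame requires that $X$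 is the set of linear names of $\Gamma$), $\equiv$ for structural congruence, $\longrightarrow$ for call-by-value process reduction in evaluation contexts (closed under $\mid$, $\nu$ and $\equiv$), and $\longrightarrow^*$ for its reflexive transitive closure. *Errors.* An *abstraction* is $\lambda_m x.e$, possibly wrapped in casts between function types. The *subject* of each of $\mathsf{send}\ f\ c$, $\mathsf{receive}\ c$, $\mathsf{select}\ l\ c$, $\mathsf{case}\ c\ \mathsf{of}\ \{\dots\}$, $\mathsf{close}\ c$, $\mathsf{wait}\ c$ is the endpoint $c$; other expressions have no subject. Two expressions *agree* on $\{c,d\}$ if, up to exchanging $c$ with $d$ and the two expressions with each other, they are $\mathsf{send}\ g\ c$ and $\mathsf{receive}\ d$ (for any expression $g$), or $\mathsf{select}\ l_j\ c$ and $\mathsf{case}\ d\ \mathsf{of}\ \{l_i:x_i.f_i\}_{i\in I}$ with $j\in I$, or $\mathsf{close}\ c$ and $\mathsf{wait}\ d$. With $E,F$ evaluation contexts, a process is an *error* if it is structurally congruent to a process with a subprocess of one of the forms 1. $\langle E[v\,e]\rangle$, where $v$ is a value or a variable, and not an abstraction; 2. $\langle E[\mathsf{let}\ x,y=v\ \mathsf{in}\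 e]\rangle$, where $v$ is a value or a variable, and not a pair; 3. $\langle E[e]\rangle\mid\langle F[f]\rangle$, where $e$ and $f$ have the same subject; 4. $(\nu c,d)(\langle E[e]\rangle\mid\langle F[f]\rangle)$, where $e$ has subject $c$, $f$ has subject $d$, and $e,f$ do not agree on $\{c,d\}$. *Claim.* Let $\Gamma\vdash P$, where $\Gamma$ assigns no function type and no pair type to a name, and suppose that both types of every cast occurring in $P$ are well formed. If $P\longrightarrow^* Q$, then $Q$ is not an error. -/

import Mathlib

/-! The internal language of Gradual GV: types, expressions, typing, reduction, run-time errors.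

Names are of three kinds: variables, channel endpoints and references. Each kind has its own
de Bruijn indices, so `α`-equivalent terms are equal and the variable convention is built in:
* `lam`, and each branch of `caseOf`, binds the variable `0`;
* `letPair e f` (that is `let x, y = e in f`) binds in `f` the variables `1` (for `x`) and `0`
  (for `y`);
* `nuChan P` (that is `(ν c,d) P`) binds in `P` the endpoints `0` (for `c`) and `1` (for `d`);
* `nuRef P` (that is `(ν a) P`) binds in `P` the reference `0`. -/

namespace GGV

/-! ### Types -/

inductive Mult
  | lin
  | un

/-- The order on multiplicities: `un ⊑ un`, `un ⊑ lin`, `lin ⊑ lin`. -/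
inductive Mult.Le : Mult → Mult → Prop
  | un_un : Mult.Le Mult.un Mult.un
  | un_lin : Mult.Le Mult.un Mult.lin
  | lin_lin : Mult.Le Mult.lin Mult.lin

abbrev Label := ℕ

mutual
/-- Types; `dyn` is the dynamic type. -/
inductive Ty
  | unit : Ty
  | sess : STy → Ty
  | arrow : Mult → Ty → Ty → Ty
  | prod : Mult → Ty → Ty → Ty
  | dyn : Ty
/-- Session types; `dyn` is the dynamic session type, `select` is `⊕` and `branch` is `&`, both
over a non-empty finite set of labels, `close` is `end!` and `wait` is `end?`. -/
inductive STy
  | send : Ty → STy → STy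
  | recv : Ty → STy → STy
  | select : (I : Finset Label) → I.Nonempty → ({l // l ∈ I} → STy) → STy
  | branch : (I : Finset Label) → I.Nonempty → ({l // l ∈ I} → STy) → STy
  | close : STy
  | wait : STy
  | dyn : STy
end

def STy.dual : STy → STy
  | .send T S => .recv T S.dual
  | .recv T S => .send T S.dual
  | .select I h S => .branch I h (fun i => (S i).dual)
  | .branch I h S => .select I h (fun i => (S i).dual)
  | .close => .wait
  | .wait => .close
  | .dyn => .dyn

/-- The multiplicity of a type: `m(T)` is `T.mult = m`. -/
def Ty.mult : Ty → Mult
  | .unit => .un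
  | .sess _ => .lin
  | .arrow m _ _ => m
  | .prod m _ _ => m
  | .dyn => .un

mutual
/-- Subtyping of types. -/
inductive Ty.Sub : Ty → Ty → Prop
  | unit : Ty.Sub .unit .unit
  | sess {S R : STy} : STy.Sub S R → Ty.Sub (.sess S) (.sess R)
  | arrow {m n : Mult} {T U T' U' : Ty} :
      Ty.Sub T' T → Ty.Sub U U' → Mult.Le m n → Ty.Sub (.arrow m T U) (.arrow n T' U')
  | prod {m n : Mult} {T U T' U' : Ty} :
      Ty.Sub T T' → Ty.Sub U U' → Mult.Le m n → Ty.Sub (.prod m T U) (.prod n T' U')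
  | dyn : Ty.Sub .dyn .dyn
/-- Subtyping of session types. -/
inductive STy.Sub : STy → STy → Prop
  | send {T T' : Ty} {S S' : STy} :
      Ty.Sub T' T → STy.Sub S S' → STy.Sub (.send T S) (.send T' S')
  | recv {T T' : Ty} {S S' : STy} :
      Ty.Sub T T' → STy.Sub S S' → STy.Sub (.recv T S) (.recv T' S')
  | select {I J : Finset Label} {hI : I.Nonempty} {hJ : J.Nonempty}
      {S : {l // l ∈ I} → STy} {R : {l // l ∈ J} → STy} (h : J ⊆ I) :
      (∀ (j : Label) (hj : j ∈ J), STy.Sub (S ⟨j, h hj⟩) (R ⟨j, hj⟩)) →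
      STy.Sub (.select I hI S) (.select J hJ R)
  | branch {I J : Finset Label} {hI : I.Nonempty} {hJ : J.Nonempty}
      {S : {l // l ∈ I} → STy} {R : {l // l ∈ J} → STy} (h : I ⊆ J) :
      (∀ (i : Label) (hi : i ∈ I), STy.Sub (S ⟨i, hi⟩) (R ⟨i, h hi⟩)) →
      STy.Sub (.branch I hI S) (.branch J hJ R)
  | close : STy.Sub .close .close
  | wait : STy.Sub .wait .wait
  | dyn : STy.Sub .dyn .dyn
end

mutual
/-- Consistent subtyping `≲` of types. -/
inductive Ty.CSub : Ty → Ty → Prop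
  | unit : Ty.CSub .unit .unit
  | sess {S R : STy} : STy.CSub S R → Ty.CSub (.sess S) (.sess R)
  | arrow {m n : Mult} {T U T' U' : Ty} :
      Ty.CSub T' T → Ty.CSub U U' → Mult.Le m n → Ty.CSub (.arrow m T U) (.arrow n T' U')
  | prod {m n : Mult} {T U T' U' : Ty} :
      Ty.CSub T T' → Ty.CSub U U' → Mult.Le m n → Ty.CSub (.prod m T U) (.prod n T' U')
  | dyn_left (T : Ty) : Ty.CSub .dyn T
  | dyn_right (T : Ty) : Ty.CSub T .dyn
/-- Consistent subtyping `≲` of session types. -/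
inductive STy.CSub : STy → STy → Prop
  | send {T T' : Ty} {S S' : STy} :
      Ty.CSub T' T → STy.CSub S S' → STy.CSub (.send T S) (.send T' S')
  | recv {T T' : Ty} {S S' : STy} :
      Ty.CSub T T' → STy.CSub S S' → STy.CSub (.recv T S) (.recv T' S')
  | select {I J : Finset Label} {hI : I.Nonempty} {hJ : J.Nonempty}
      {S : {l // l ∈ I} → STy} {R : {l // l ∈ J} → STy} (h : J ⊆ I) :
      (∀ (j : Label) (hj : j ∈ J), STy.CSub (S ⟨j, h hj⟩) (R ⟨j, hj⟩)) →
      STy.CSub (.select I hI S) (.select J hJ R)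
  | branch {I J : Finset Label} {hI : I.Nonempty} {hJ : J.Nonempty}
      {S : {l // l ∈ I} → STy} {R : {l // l ∈ J} → STy} (h : I ⊆ J) :
      (∀ (i : Label) (hi : i ∈ I), STy.CSub (S ⟨i, hi⟩) (R ⟨i, h hi⟩)) →
      STy.CSub (.branch I hI S) (.branch J hJ R)
  | close : STy.CSub .close .close
  | wait : STy.CSub .wait .wait
  | dyn_left (S : STy) : STy.CSub .dyn S
  | dyn_right (S : STy) : STy.CSub S .dyn
end

/-- Consistency `T ∼ U`. -/
def Ty.Consistent (T U : Ty) : Prop := Ty.CSub T U ∧ Ty.CSub U T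

def STy.Consistent (S R : STy) : Prop := STy.CSub S R ∧ STy.CSub R S

inductive Ty.Ground : Ty → Prop
  | unit : Ty.Ground .unit
  | sess : Ty.Ground (.sess .dyn)
  | arrow (m : Mult) : Ty.Ground (.arrow m .dyn .dyn)
  | prod (m : Mult) : Ty.Ground (.prod m .dyn .dyn)

inductive STy.Ground : STy → Prop
  | send : STy.Ground (.send .dyn .dyn)
  | recv : STy.Ground (.recv .dyn .dyn)
  | select (I : Finset Label) (h : I.Nonempty) : STy.Ground (.select I h (fun _ => .dyn))
  | branch (I : Finset Label) (h : I.Nonempty) : STy.Ground (.branch I h (fun _ => .dyn))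
  | close : STy.Ground .close
  | wait : STy.Ground .wait

mutual
/-- `T` is well formed: no unrestricted pair type that occurs in `T`, at any depth, has a
component of linear type. -/
def Ty.WellFormed : Ty → Prop
  | .unit => True
  | .sess S => S.WellFormed
  | .arrow _ T U => T.WellFormed ∧ U.WellFormed
  | .prod m T U => (m = .un → T.mult = .un ∧ U.mult = .un) ∧ T.WellFormed ∧ U.WellFormed
  | .dyn => True
def STy.WellFormed : STy → Prop
  | .send T S => T.WellFormed ∧ S.WellFormed
  | .recv T S => T.WellFormed ∧ S.WellFormed
  | .select _ _ S => ∀ i, (S i).WellFormed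
  | .branch _ _ S => ∀ i, (S i).WellFormed
  | .close => True
  | .wait => True
  | .dyn => True
end

/-! ### Names, expressions and processes -/

/-- A blame label: an identifier with a polarity. -/
structure BlameLabel where
  ident : ℕ
  positive : Bool

/-- The complement of a blame label. -/
def BlameLabel.compl (p : BlameLabel) : BlameLabel := ⟨p.ident, !p.positive⟩

inductive Name
  | var : ℕ → Name
  | chan : ℕ → Name
  | ref : ℕ → Name
  deriving DecidableEq

inductive Expr
  | name : Name → Expr
  | unit : Expr
  | lam : Mult → Expr → Expr
  | app : Expr → Expr → Expr
  | pair : Mult → Expr → Expr → Expr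
  | letPair : Expr → Expr → Expr
  | fork : Expr → Expr
  | new : Expr
  | send : Expr → Expr → Expr
  | recv : Expr → Expr
  | select : Label → Expr → Expr
  | caseOf : Expr → (I : Finset Label) → ({l // l ∈ I} → Expr) → Expr
  | close : Expr → Expr
  | wait : Expr → Expr
  | cast : Expr → Ty → BlameLabel → Ty → Expr

abbrev Expr.var (x : ℕ) : Expr := .name (.var x)
abbrev Expr.chan (c : ℕ) : Expr := .name (.chan c)
abbrev Expr.ref (a : ℕ) : Expr := .name (.ref a)

/-- Processes: `store a w G p` is `a ↦ w : G ⇒ᵖ dyn`, `locked a p` is `a ↦ locked p`,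
`blameBoth p q X` and `blameOne p X` are the two forms of blame. -/
inductive Proc
  | thread : Expr → Proc
  | par : Proc → Proc → Proc
  | nuChan : Proc → Proc
  | nuRef : Proc → Proc
  | store : ℕ → Expr → Ty → BlameLabel → Proc
  | locked : ℕ → BlameLabel → Proc
  | blameBoth : BlameLabel → BlameLabel → Finset Name → Proc
  | blameOne : BlameLabel → Finset Name → Proc

/-! ### Renaming and substitution -/

/-- A renaming of the three kinds of names. -/
structure Ren where
  var : ℕ → ℕ
  chan : ℕ → ℕ
  ref : ℕ → ℕ

/-- The renaming under the binder of one variable. -/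
def Ren.liftVar (ρ : Ren) : Ren :=
  { ρ with var := fun n => match n with | 0 => 0 | n + 1 => ρ.var n + 1 }

/-- The renaming under the binder of two channel endpoints. -/
def Ren.liftChan (ρ : Ren) : Ren :=
  { ρ with chan := fun n => match n with | 0 => 0 | 1 => 1 | n + 2 => ρ.chan n + 2 }

/-- The renaming under the binder of one reference. -/
def Ren.liftRef (ρ : Ren) : Ren :=
  { ρ with ref := fun n => match n with | 0 => 0 | n + 1 => ρ.ref n + 1 }

/-- Weakening by one variable. -/
def Ren.shiftVar : Ren := ⟨fun n => n + 1, id, id⟩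
/-- Weakening by two channel endpoints. -/
def Ren.shiftChan : Ren := ⟨id, fun n => n + 2, id⟩
/-- Weakening by one reference. -/
def Ren.shiftRef : Ren := ⟨id, id, fun n => n + 1⟩
/-- Exchange of the two endpoints of the innermost channel. -/
def Ren.swapEnds : Ren :=
  ⟨id, fun n => match n with | 0 => 1 | 1 => 0 | n + 2 => n + 2, id⟩
/-- Exchange of the two innermost channels. -/
def Ren.swapChans : Ren :=
  ⟨id, fun n => match n with | 0 => 2 | 1 => 3 | 2 => 0 | 3 => 1 | n + 4 => n + 4, id⟩
/-- Exchange of the two innermost references. -/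
def Ren.swapRefs : Ren :=
  ⟨id, id, fun n => match n with | 0 => 1 | 1 => 0 | n + 2 => n + 2⟩

def Name.rename (ρ : Ren) : Name → Name
  | .var n => .var (ρ.var n)
  | .chan n => .chan (ρ.chan n)
  | .ref n => .ref (ρ.ref n)

def Expr.rename : Ren → Expr → Expr
  | ρ, .name z => .name (z.rename ρ)
  | _, .unit => .unit
  | ρ, .lam m e => .lam m (e.rename ρ.liftVar)
  | ρ, .app e f => .app (e.rename ρ) (f.rename ρ)
  | ρ, .pair m e f => .pair m (e.rename ρ) (f.rename ρ)
  | ρ, .letPair e f => .letPair (e.rename ρ) (f.rename ρ.liftVar.liftVar)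
  | ρ, .fork e => .fork (e.rename ρ)
  | _, .new => .new
  | ρ, .send e f => .send (e.rename ρ) (f.rename ρ)
  | ρ, .recv e => .recv (e.rename ρ)
  | ρ, .select l e => .select l (e.rename ρ)
  | ρ, .caseOf e I br => .caseOf (e.rename ρ) I (fun i => (br i).rename ρ.liftVar)
  | ρ, .close e => .close (e.rename ρ)
  | ρ, .wait e => .wait (e.rename ρ)
  | ρ, .cast e T p U => .cast (e.rename ρ) T p U

def Proc.rename : Ren → Proc → Proc
  | ρ, .thread e => .thread (e.rename ρ)
  | ρ, .par P Q => .par (P.rename ρ) (Q.rename ρ)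
  | ρ, .nuChan P => .nuChan (P.rename ρ.liftChan)
  | ρ, .nuRef P => .nuRef (P.rename ρ.liftRef)
  | ρ, .store a w G p => .store (ρ.ref a) (w.rename ρ) G p
  | ρ, .locked a p => .locked (ρ.ref a) p
  | ρ, .blameBoth p q X => .blameBoth p q (X.image (Name.rename ρ))
  | ρ, .blameOne p X => .blameOne p (X.image (Name.rename ρ))

/-- A substitution for variables under the binder of one variable. -/
def liftSubst (σ : ℕ → Expr) : ℕ → Expr
  | 0 => .var 0
  | n + 1 => (σ n).rename .shiftVar

/-- Simultaneous capture-avoiding substitution for variables. -/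
def Expr.subst : (ℕ → Expr) → Expr → Expr
  | σ, .name (.var n) => σ n
  | _, .name (.chan n) => .chan n
  | _, .name (.ref n) => .ref n
  | _, .unit => .unit
  | σ, .lam m e => .lam m (e.subst (liftSubst σ))
  | σ, .app e f => .app (e.subst σ) (f.subst σ)
  | σ, .pair m e f => .pair m (e.subst σ) (f.subst σ)
  | σ, .letPair e f => .letPair (e.subst σ) (f.subst (liftSubst (liftSubst σ)))
  | σ, .fork e => .fork (e.subst σ)
  | _, .new => .new
  | σ, .send e f => .send (e.subst σ) (f.subst σ)
  | σ, .recv e => .recv (e.subst σ)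
  | σ, .select l e => .select l (e.subst σ)
  | σ, .caseOf e I br => .caseOf (e.subst σ) I (fun i => (br i).subst (liftSubst σ))
  | σ, .close e => .close (e.subst σ)
  | σ, .wait e => .wait (e.subst σ)
  | σ, .cast e T p U => .cast (e.subst σ) T p U

/-- `e[v/x]`, where `x` is the variable `0` of `e`. -/
def Expr.inst (e v : Expr) : Expr :=
  e.subst (fun n => match n with | 0 => v | n + 1 => .var n)

/-- `e[v/x][w/y]`, where `x` and `y` are the variables `1` and `0` of `e`. -/
def Expr.instPair (e v w : Expr) : Expr :=
  e.subst (fun n => match n with | 0 => w | 1 => v | n + 2 => .var n)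

/-- The free linear names of an expression. In a running program these are its channel
endpoints, and expressions do not bind endpoints. -/
def Expr.flv : Expr → Finset Name
  | .name (.chan c) => {.chan c}
  | .name (.var _) => ∅
  | .name (.ref _) => ∅
  | .unit => ∅
  | .lam _ e => e.flv
  | .app e f => e.flv ∪ f.flv
  | .pair _ e f => e.flv ∪ f.flv
  | .letPair e f => e.flv ∪ f.flv
  | .fork e => e.flv
  | .new => ∅
  | .send e f => e.flv ∪ f.flv
  | .recv e => e.flv
  | .select _ e => e.flv
  | .caseOf e I br => e.flv ∪ I.attach.biUnion (fun i => (br i).flv)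
  | .close e => e.flv
  | .wait e => e.flv
  | .cast e _ _ _ => e.flv

/-- Both types of every cast that occurs in the expression are well formed. -/
def Expr.CastsWellFormed : Expr → Prop
  | .name _ => True
  | .unit => True
  | .lam _ e => e.CastsWellFormed
  | .app e f => e.CastsWellFormed ∧ f.CastsWellFormed
  | .pair _ e f => e.CastsWellFormed ∧ f.CastsWellFormed
  | .letPair e f => e.CastsWellFormed ∧ f.CastsWellFormed
  | .fork e => e.CastsWellFormed
  | .new => True
  | .send e f => e.CastsWellFormed ∧ f.CastsWellFormed
  | .recv e => e.CastsWellFormed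
  | .select _ e => e.CastsWellFormed
  | .caseOf e _ br => e.CastsWellFormed ∧ ∀ i, (br i).CastsWellFormed
  | .close e => e.CastsWellFormed
  | .wait e => e.CastsWellFormed
  | .cast e T _ U => e.CastsWellFormed ∧ T.WellFormed ∧ U.WellFormed

/-- Both types of every cast that occurs in the process are well formed. -/
def Proc.CastsWellFormed : Proc → Prop
  | .thread e => e.CastsWellFormed
  | .par P Q => P.CastsWellFormed ∧ Q.CastsWellFormed
  | .nuChan P => P.CastsWellFormed
  | .nuRef P => P.CastsWellFormed
  | .store _ w G _ => w.CastsWellFormed ∧ G.WellFormed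
  | .locked _ _ => True
  | .blameBoth _ _ _ => True
  | .blameOne _ _ => True

/-! ### Values and evaluation contexts -/

inductive Expr.IsValue : Expr → Prop
  | unit : Expr.IsValue .unit
  | lam (m : Mult) (e : Expr) : Expr.IsValue (.lam m e)
  | pair (m : Mult) {v w : Expr} : v.IsValue → w.IsValue → Expr.IsValue (.pair m v w)
  | chan (c : ℕ) : Expr.IsValue (.chan c)
  | ref (a : ℕ) : Expr.IsValue (.ref a)
  | castDyn {v : Expr} {G : Ty} (p : BlameLabel) :
      v.IsValue → G.Ground → G.mult = .un → Expr.IsValue (.cast v G p .dyn)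
  | castSDyn {v : Expr} {G : STy} (p : BlameLabel) :
      v.IsValue → G.Ground → Expr.IsValue (.cast v (.sess G) p (.sess .dyn))
  | castArrow {v : Expr} (m n : Mult) (T U T' U' : Ty) (p : BlameLabel) :
      v.IsValue → Expr.IsValue (.cast v (.arrow m T U) p (.arrow n T' U'))
  | castSess {v : Expr} {S R : STy} (p : BlameLabel) :
      v.IsValue → S ≠ .dyn → R ≠ .dyn → Expr.IsValue (.cast v (.sess S) p (.sess R))

/-- Expressions with one hole that is not under a binder. -/
inductive Ctx
  | hole : Ctx
  | appL : Ctx → Expr → Ctx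
  | appR : Expr → Ctx → Ctx
  | pairL : Mult → Ctx → Expr → Ctx
  | pairR : Mult → Expr → Ctx → Ctx
  | letPair : Ctx → Expr → Ctx
  | sendL : Ctx → Expr → Ctx
  | sendR : Expr → Ctx → Ctx
  | recv : Ctx → Ctx
  | select : Label → Ctx → Ctx
  | caseOf : Ctx → (I : Finset Label) → ({l // l ∈ I} → Expr) → Ctx
  | close : Ctx → Ctx
  | wait : Ctx → Ctx
  | cast : Ctx → Ty → BlameLabel → Ty → Ctx

/-- `E` is an evaluation context: what stands to the left of the hole is a value. -/
def Ctx.IsEval : Ctx → Prop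
  | .hole => True
  | .appL E _ => E.IsEval
  | .appR v E => v.IsValue ∧ E.IsEval
  | .pairL _ E _ => E.IsEval
  | .pairR _ v E => v.IsValue ∧ E.IsEval
  | .letPair E _ => E.IsEval
  | .sendL E _ => E.IsEval
  | .sendR v E => v.IsValue ∧ E.IsEval
  | .recv E => E.IsEval
  | .select _ E => E.IsEval
  | .caseOf E _ _ => E.IsEval
  | .close E => E.IsEval
  | .wait E => E.IsEval
  | .cast E _ _ _ => E.IsEval

/-- `E[e]`. -/
def Ctx.fill : Ctx → Expr → Expr
  | .hole, e => e
  | .appL E f, e => .app (E.fill e) f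
  | .appR v E, e => .app v (E.fill e)
  | .pairL m E f, e => .pair m (E.fill e) f
  | .pairR m v E, e => .pair m v (E.fill e)
  | .letPair E f, e => .letPair (E.fill e) f
  | .sendL E f, e => .send (E.fill e) f
  | .sendR v E, e => .send v (E.fill e)
  | .recv E, e => .recv (E.fill e)
  | .select l E, e => .select l (E.fill e)
  | .caseOf E I br, e => .caseOf (E.fill e) I br
  | .close E, e => .close (E.fill e)
  | .wait E, e => .wait (E.fill e)
  | .cast E T p U, e => .cast (E.fill e) T p U

/-- `F[E]`, the composition of contexts. -/
def Ctx.comp : Ctx → Ctx → Ctx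
  | .hole, E => E
  | .appL F f, E => .appL (F.comp E) f
  | .appR v F, E => .appR v (F.comp E)
  | .pairL m F f, E => .pairL m (F.comp E) f
  | .pairR m v F, E => .pairR m v (F.comp E)
  | .letPair F f, E => .letPair (F.comp E) f
  | .sendL F f, E => .sendL (F.comp E) f
  | .sendR v F, E => .sendR v (F.comp E)
  | .recv F, E => .recv (F.comp E)
  | .select l F, E => .select l (F.comp E)
  | .caseOf F I br, E => .caseOf (F.comp E) I br
  | .close F, E => .close (F.comp E)
  | .wait F, E => .wait (F.comp E)
  | .cast F T p U, E => .cast (F.comp E) T p U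

def Ctx.rename (ρ : Ren) : Ctx → Ctx
  | .hole => .hole
  | .appL E f => .appL (E.rename ρ) (f.rename ρ)
  | .appR v E => .appR (v.rename ρ) (E.rename ρ)
  | .pairL m E f => .pairL m (E.rename ρ) (f.rename ρ)
  | .pairR m v E => .pairR m (v.rename ρ) (E.rename ρ)
  | .letPair E f => .letPair (E.rename ρ) (f.rename ρ.liftVar.liftVar)
  | .sendL E f => .sendL (E.rename ρ) (f.rename ρ)
  | .sendR v E => .sendR (v.rename ρ) (E.rename ρ)
  | .recv E => .recv (E.rename ρ)
  | .select l E => .select l (E.rename ρ)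
  | .caseOf E I br => .caseOf (E.rename ρ) I (fun i => (br i).rename ρ.liftVar)
  | .close E => .close (E.rename ρ)
  | .wait E => .wait (E.rename ρ)
  | .cast E T p U => .cast (E.rename ρ) T p U

/-- The free linear names (channel endpoints) of a context. -/
def Ctx.flv : Ctx → Finset Name
  | .hole => ∅
  | .appL E f => E.flv ∪ f.flv
  | .appR v E => v.flv ∪ E.flv
  | .pairL _ E f => E.flv ∪ f.flv
  | .pairR _ v E => v.flv ∪ E.flv
  | .letPair E f => E.flv ∪ f.flv
  | .sendL E f => E.flv ∪ f.flv
  | .sendR v E => v.flv ∪ E.flv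
  | .recv E => E.flv
  | .select _ E => E.flv
  | .caseOf E I br => E.flv ∪ I.attach.biUnion (fun i => (br i).flv)
  | .close E => E.flv
  | .wait E => E.flv
  | .cast E _ _ _ => E.flv

/-! ### Typing -/

/-- Type environments, as partial maps from names to types. -/
abbrev Env := Name → Option Ty

/-- `Γ, x : T`, for a new variable `x`. -/
def Env.consVar (Γ : Env) (T : Ty) : Env
  | .var 0 => some T
  | .var (n + 1) => Γ (.var n)
  | z => Γ z

/-- `Γ, c : T, d : U`, for new channel endpoints `c` and `d`. -/
def Env.consChan (Γ : Env) (T U : Ty) : Env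
  | .chan 0 => some T
  | .chan 1 => some U
  | .chan (n + 2) => Γ (.chan n)
  | z => Γ z

/-- `Γ, a : T`, for a new reference `a`. -/
def Env.consRef (Γ : Env) (T : Ty) : Env
  | .ref 0 => some T
  | .ref (n + 1) => Γ (.ref n)
  | z => Γ z

/-- `un(Γ)`. -/
def Env.IsUn (Γ : Env) : Prop := ∀ z T, Γ z = some T → T.mult = .un

/-- Every type `T` in `Γ` satisfies `m'(T)` for some `m' ⊑ m`. -/
def Env.Below (m : Mult) (Γ : Env) : Prop := ∀ z T, Γ z = some T → Mult.Le T.mult m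

/-- `flv(Γ)`, the set of the names of linear type in `Γ`. -/
def Env.flv (Γ : Env) : Set Name := {z | ∃ T, Γ z = some T ∧ T.mult = .lin}

/-- Environment splitting at one name. -/
inductive SplitAt : Option Ty → Option Ty → Option Ty → Prop
  | absent : SplitAt none none none
  | un {T : Ty} : T.mult = .un → SplitAt (some T) (some T) (some T)
  | linL {T : Ty} : T.mult = .lin → SplitAt (some T) (some T) none
  | linR {T : Ty} : T.mult = .lin → SplitAt (some T) none (some T)

/-- `Γ = Γ₁ ∘ Γ₂`. -/
def Env.Split (Γ Γ₁ Γ₂ : Env) : Prop := ∀ z, SplitAt (Γ z) (Γ₁ z) (Γ₂ z)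

/-- Typing of expressions, `Γ ⊢ e : T`. -/
inductive HasType : Env → Expr → Ty → Prop
  | name {Γ : Env} {z : Name} {T : Ty} :
      Γ z = some T → (∀ z' U, z' ≠ z → Γ z' = some U → U.mult = .un) → HasType Γ (.name z) T
  | unit {Γ : Env} : Γ.IsUn → HasType Γ .unit .unit
  | lam {Γ : Env} {m : Mult} {e : Expr} {T U : Ty} :
      HasType (Γ.consVar T) e U → Γ.Below m → HasType Γ (.lam m e) (.arrow m T U)
  | app {Γ Γ₁ Γ₂ : Env} {m : Mult} {e f : Expr} {T U : Ty} :
      Γ.Split Γ₁ Γ₂ → HasType Γ₁ e (.arrow m T U) → HasType Γ₂ f T → HasType Γ (.app e f) U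
  | pair {Γ Γ₁ Γ₂ : Env} {m : Mult} {e f : Expr} {T U : Ty} :
      Γ.Split Γ₁ Γ₂ → HasType Γ₁ e T → HasType Γ₂ f U → Mult.Le T.mult m → Mult.Le U.mult m →
      HasType Γ (.pair m e f) (.prod m T U)
  | letPair {Γ Γ₁ Γ₂ : Env} {m : Mult} {e f : Expr} {T₁ T₂ U : Ty} :
      Γ.Split Γ₁ Γ₂ → HasType Γ₁ e (.prod m T₁ T₂) →
      HasType ((Γ₂.consVar T₁).consVar T₂) f U → HasType Γ (.letPair e f) U
  | fork {Γ : Env} {e : Expr} : HasType Γ e .unit → HasType Γ (.fork e) .unit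
  | new {Γ : Env} (S : STy) :
      Γ.IsUn → HasType Γ .new (.prod .lin (.sess S) (.sess S.dual))
  | send {Γ Γ₁ Γ₂ : Env} {e f : Expr} {T : Ty} {S : STy} :
      Γ.Split Γ₁ Γ₂ → HasType Γ₁ e T → HasType Γ₂ f (.sess (.send T S)) →
      HasType Γ (.send e f) (.sess S)
  | recv {Γ : Env} {e : Expr} {T : Ty} {S : STy} :
      HasType Γ e (.sess (.recv T S)) → HasType Γ (.recv e) (.prod .lin T (.sess S))
  | select {Γ : Env} {e : Expr} {I : Finset Label} {hI : I.Nonempty}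
      {S : {l // l ∈ I} → STy} (j : {l // l ∈ I}) :
      HasType Γ e (.sess (.select I hI S)) → HasType Γ (.select j e) (.sess (S j))
  | caseOf {Γ Γ₁ Γ₂ : Env} {e : Expr} {I : Finset Label} {hI : I.Nonempty}
      {S : {l // l ∈ I} → STy} {br : {l // l ∈ I} → Expr} {T : Ty} :
      Γ.Split Γ₁ Γ₂ → HasType Γ₁ e (.sess (.branch I hI S)) →
      (∀ i, HasType (Γ₂.consVar (.sess (S i))) (br i) T) → HasType Γ (.caseOf e I br) T
  | close {Γ : Env} {e : Expr} : HasType Γ e (.sess .close) → HasType Γ (.close e) .unit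
  | wait {Γ : Env} {e : Expr} : HasType Γ e (.sess .wait) → HasType Γ (.wait e) .unit
  | sub {Γ : Env} {e : Expr} {T U : Ty} : HasType Γ e T → Ty.Sub T U → HasType Γ e U
  | cast {Γ : Env} {e : Expr} {T U : Ty} (p : BlameLabel) :
      HasType Γ e T → Ty.CSub T U → HasType Γ (.cast e T p U) U

/-- Typing of processes, `Γ ⊢ P`. In `a ↦ w : G ⇒ᵖ dyn` the grammar asks for a value `w` and a
ground type `G`; this is checked here. -/
inductive Proc.WellTyped : Env → Proc → Prop
  | thread {Γ : Env} {e : Expr} {T : Ty} :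
      HasType Γ e T → T.mult = .un → Proc.WellTyped Γ (.thread e)
  | par {Γ Γ₁ Γ₂ : Env} {P Q : Proc} :
      Γ.Split Γ₁ Γ₂ → Proc.WellTyped Γ₁ P → Proc.WellTyped Γ₂ Q → Proc.WellTyped Γ (.par P Q)
  | nuChan {Γ : Env} {P : Proc} (S : STy) :
      Proc.WellTyped (Γ.consChan (.sess S) (.sess S.dual)) P → Proc.WellTyped Γ (.nuChan P)
  | nuRef {Γ : Env} {P : Proc} :
      Proc.WellTyped (Γ.consRef .dyn) P → Proc.WellTyped Γ (.nuRef P)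
  | store {Γ Γ₁ Γ₂ : Env} {a : ℕ} {w : Expr} {G : Ty} (p : BlameLabel) :
      Γ.Split Γ₁ Γ₂ → HasType Γ₁ (.ref a) .dyn → HasType Γ₂ w G → G.mult = .lin →
      w.IsValue → G.Ground → Proc.WellTyped Γ (.store a w G p)
  | locked {Γ : Env} {a : ℕ} (p : BlameLabel) :
      HasType Γ (.ref a) .dyn → Proc.WellTyped Γ (.locked a p)
  | blameBoth {Γ : Env} {X : Finset Name} (p q : BlameLabel) :
      Γ.flv = ↑X → Proc.WellTyped Γ (.blameBoth p q X)
  | blameOne {Γ : Env} {X : Finset Name} (p : BlameLabel) :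
      Γ.flv = ↑X → Proc.WellTyped Γ (.blameOne p X)

/-! ### Reduction -/

/-- Reduction of expressions, `e ⟶ f`. -/
inductive Expr.Step : Expr → Expr → Prop
  | beta {m : Mult} {e v : Expr} : v.IsValue → Expr.Step (.app (.lam m e) v) (e.inst v)
  | letPair {m : Mult} {v w e : Expr} : v.IsValue → w.IsValue →
      Expr.Step (.letPair (.pair m v w) e) (e.instPair v w)
  | castDyn {v : Expr} {p : BlameLabel} : v.IsValue → Expr.Step (.cast v .dyn p .dyn) v
  | castSDyn {v : Expr} {p : BlameLabel} : v.IsValue →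
      Expr.Step (.cast v (.sess .dyn) p (.sess .dyn)) v
  | castUnit {v : Expr} {p : BlameLabel} : v.IsValue → Expr.Step (.cast v .unit p .unit) v
  | appCast {v w : Expr} {m n : Mult} {T U T' U' : Ty} {p : BlameLabel} :
      v.IsValue → w.IsValue →
      Expr.Step (.app (.cast v (.arrow m T U) p (.arrow n T' U')) w)
        (.cast (.app v (.cast w T' p.compl T)) U p U')
  | castPair {v w : Expr} {m n : Mult} {T U T' U' : Ty} {p : BlameLabel} :
      v.IsValue → w.IsValue →
      Expr.Step (.cast (.pair m v w) (.prod m T U) p (.prod n T' U'))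
        (.pair n (.cast v T p T') (.cast w U p U'))
  | sendCast {v w : Expr} {T T' : Ty} {S S' : STy} {p : BlameLabel} :
      v.IsValue → w.IsValue →
      Expr.Step (.send v (.cast w (.sess (.send T S)) p (.sess (.send T' S'))))
        (.cast (.send (.cast v T' p.compl T) w) (.sess S) p (.sess S'))
  | recvCast {w : Expr} {T T' : Ty} {S S' : STy} {p : BlameLabel} :
      w.IsValue →
      Expr.Step (.recv (.cast w (.sess (.recv T S)) p (.sess (.recv T' S'))))
        (.cast (.recv w) (.prod .lin T (.sess S)) p (.prod .lin T' (.sess S')))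
  | selectCast {w : Expr} {I J : Finset Label} {hI : I.Nonempty} {hJ : J.Nonempty}
      {R : {l // l ∈ I} → STy} {S : {l // l ∈ J} → STy} {p : BlameLabel}
      {k : Label} (hk : k ∈ J) (h : J ⊆ I) :
      w.IsValue →
      Expr.Step (.select k (.cast w (.sess (.select I hI R)) p (.sess (.select J hJ S))))
        (.cast (.select k w) (.sess (R ⟨k, h hk⟩)) p (.sess (S ⟨k, hk⟩)))
  /-- Here `let x = e in f` abbreviates `(lam lin x. f) e`. -/
  | caseCast {w : Expr} {I J : Finset Label} {hI : I.Nonempty} {hJ : J.Nonempty}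
      {R : {l // l ∈ I} → STy} {S : {l // l ∈ J} → STy} {p : BlameLabel}
      {br : {l // l ∈ J} → Expr} (h : I ⊆ J) :
      w.IsValue →
      Expr.Step (.caseOf (.cast w (.sess (.branch I hI R)) p (.sess (.branch J hJ S))) J br)
        (.caseOf w I (fun i =>
          .app (.lam .lin ((br ⟨i.1, h i.2⟩).rename Ren.shiftVar.liftVar))
            (.cast (.var 0) (.sess (R i)) p (.sess (S ⟨i.1, h i.2⟩)))))
  | closeCast {v : Expr} {p : BlameLabel} : v.IsValue →
      Expr.Step (.close (.cast v (.sess .close) p (.sess .close))) (.close v)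
  | waitCast {v : Expr} {p : BlameLabel} : v.IsValue →
      Expr.Step (.wait (.cast v (.sess .wait) p (.sess .wait))) (.wait v)
  | toDyn {v : Expr} {T G : Ty} {p : BlameLabel} :
      v.IsValue → G.Ground → T ≠ .dyn → T ≠ G → T.Consistent G →
      Expr.Step (.cast v T p .dyn) (.cast (.cast v T p G) G p .dyn)
  | fromDyn {v : Expr} {T G : Ty} {p : BlameLabel} :
      v.IsValue → G.Ground → T ≠ .dyn → T ≠ G → T.Consistent G →
      Expr.Step (.cast v .dyn p T) (.cast (.cast v .dyn p G) G p T)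
  | toSDyn {v : Expr} {S G : STy} {p : BlameLabel} :
      v.IsValue → G.Ground → S ≠ .dyn → S ≠ G → S.Consistent G →
      Expr.Step (.cast v (.sess S) p (.sess .dyn))
        (.cast (.cast v (.sess S) p (.sess G)) (.sess G) p (.sess .dyn))
  | fromSDyn {v : Expr} {S G : STy} {p : BlameLabel} :
      v.IsValue → G.Ground → S ≠ .dyn → S ≠ G → S.Consistent G →
      Expr.Step (.cast v (.sess .dyn) p (.sess S))
        (.cast (.cast v (.sess .dyn) p (.sess G)) (.sess G) p (.sess S))

/-- Structural congruence, the least congruence with the given laws. -/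
inductive Proc.Cong : Proc → Proc → Prop
  | refl (P : Proc) : Proc.Cong P P
  | symm {P Q : Proc} : Proc.Cong P Q → Proc.Cong Q P
  | trans {P Q R : Proc} : Proc.Cong P Q → Proc.Cong Q R → Proc.Cong P R
  | congPar {P P' Q Q' : Proc} :
      Proc.Cong P P' → Proc.Cong Q Q' → Proc.Cong (.par P Q) (.par P' Q')
  | congNuChan {P P' : Proc} : Proc.Cong P P' → Proc.Cong (.nuChan P) (.nuChan P')
  | congNuRef {P P' : Proc} : Proc.Cong P P' → Proc.Cong (.nuRef P) (.nuRef P')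
  | parComm (P Q : Proc) : Proc.Cong (.par P Q) (.par Q P)
  | parAssoc (P Q R : Proc) : Proc.Cong (.par P (.par Q R)) (.par (.par P Q) R)
  | parUnit (P : Proc) : Proc.Cong (.par P (.thread .unit)) P
  | nuChanEnds (P : Proc) : Proc.Cong (.nuChan P) (.nuChan (P.rename .swapEnds))
  | nuChanPar (P Q : Proc) :
      Proc.Cong (.par (.nuChan P) Q) (.nuChan (.par P (Q.rename .shiftChan)))
  | nuChanChan (P : Proc) :
      Proc.Cong (.nuChan (.nuChan P)) (.nuChan (.nuChan (P.rename .swapChans)))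
  | nuRefPar (P Q : Proc) :
      Proc.Cong (.par (.nuRef P) Q) (.nuRef (.par P (Q.rename .shiftRef)))
  | nuRefRef (P : Proc) : Proc.Cong (.nuRef (.nuRef P)) (.nuRef (.nuRef (P.rename .swapRefs)))
  | nuChanRef (P : Proc) : Proc.Cong (.nuChan (.nuRef P)) (.nuRef (.nuChan P))

/-- Reduction of processes, `P ⟶ Q`. -/
inductive Proc.Step : Proc → Proc → Prop
  | fork {E : Ctx} {e : Expr} : E.IsEval →
      Proc.Step (.thread (E.fill (.fork e))) (.par (.thread (E.fill .unit)) (.thread e))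
  | new {E : Ctx} : E.IsEval →
      Proc.Step (.thread (E.fill .new))
        (.nuChan (.thread ((E.rename .shiftChan).fill (.pair .lin (.chan 0) (.chan 1)))))
  | comm {E F : Ctx} {v : Expr} : E.IsEval → F.IsEval → v.IsValue →
      Proc.Step
        (.nuChan (.par (.thread (E.fill (.send v (.chan 0))))
          (.thread (F.fill (.recv (.chan 1))))))
        (.nuChan (.par (.thread (E.fill (.chan 0)))
          (.thread (F.fill (.pair .lin v (.chan 1))))))
  | choice {E F : Ctx} {I : Finset Label} {br : {l // l ∈ I} → Expr} {j : Label} (hj : j ∈ I) :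
      E.IsEval → F.IsEval →
      Proc.Step
        (.nuChan (.par (.thread (E.fill (.select j (.chan 0))))
          (.thread (F.fill (.caseOf (.chan 1) I br)))))
        (.nuChan (.par (.thread (E.fill (.chan 0)))
          (.thread (F.fill ((br ⟨j, hj⟩).inst (.chan 1))))))
  /-- The two endpoints do not occur in the contexts, which are weakened on the left. -/
  | close {E F : Ctx} : E.IsEval → F.IsEval →
      Proc.Step
        (.nuChan (.par (.thread ((E.rename .shiftChan).fill (.close (.chan 0))))
          (.thread ((F.rename .shiftChan).fill (.wait (.chan 1))))))
        (.par (.thread (E.fill .unit)) (.thread (F.fill .unit)))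
  | alloc {E : Ctx} {v : Expr} {G : Ty} {p : BlameLabel} :
      E.IsEval → v.IsValue → G.Ground → G.mult = .lin →
      (∀ (F : Ctx) (q : BlameLabel) (U : Ty), F.IsEval → U.Ground →
        E ≠ F.comp (.cast .hole .dyn q U)) →
      Proc.Step (.thread (E.fill (.cast v G p .dyn)))
        (.nuRef (.par (.thread ((E.rename .shiftRef).fill (.ref 0)))
          (.store 0 (v.rename .shiftRef) G p)))
  | access {E : Ctx} {a : ℕ} {v : Expr} {G U : Ty} {p q : BlameLabel} :
      E.IsEval → v.IsValue → G.Ground → U.Ground →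
      Proc.Step (.par (.thread (E.fill (.cast (.ref a) .dyn q U))) (.store a v G p))
        (.par (.thread (E.fill (.cast (.cast v G p .dyn) .dyn q U))) (.locked a p))
  | accessLocked {E : Ctx} {a : ℕ} {U : Ty} {p q : BlameLabel} :
      E.IsEval → U.Ground →
      Proc.Step (.par (.thread (E.fill (.cast (.ref a) .dyn q U))) (.locked a p))
        (.par (.blameBoth p.compl q E.flv) (.locked a p))
  | freeLocked {p : BlameLabel} : Proc.Step (.nuRef (.locked 0 p)) (.thread .unit)
  | freeStore {w : Expr} {G : Ty} {p : BlameLabel} : w.IsValue → G.Ground →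
      Proc.Step (.nuRef (.store 0 w G p)) (.blameOne p.compl w.flv)
  | collapse {E : Ctx} {v : Expr} {G U : Ty} {p q : BlameLabel} :
      E.IsEval → v.IsValue → G.Ground → U.Ground → Ty.Sub G U →
      Proc.Step (.thread (E.fill (.cast (.cast v G p .dyn) .dyn q U))) (.thread (E.fill v))
  | collide {E : Ctx} {v : Expr} {G U : Ty} {p q : BlameLabel} :
      E.IsEval → v.IsValue → G.Ground → U.Ground → ¬ Ty.Sub G U →
      Proc.Step (.thread (E.fill (.cast (.cast v G p .dyn) .dyn q U)))
        (.blameBoth p.compl q (E.flv ∪ v.flv))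
  | collapseS {E : Ctx} {v : Expr} {G R : STy} {p q : BlameLabel} :
      E.IsEval → v.IsValue → G.Ground → R.Ground → STy.Sub G R →
      Proc.Step
        (.thread (E.fill
          (.cast (.cast v (.sess G) p (.sess .dyn)) (.sess .dyn) q (.sess R))))
        (.thread (E.fill v))
  | collideS {E : Ctx} {v : Expr} {G R : STy} {p q : BlameLabel} :
      E.IsEval → v.IsValue → G.Ground → R.Ground → ¬ STy.Sub G R →
      Proc.Step
        (.thread (E.fill
          (.cast (.cast v (.sess G) p (.sess .dyn)) (.sess .dyn) q (.sess R))))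
        (.blameBoth p.compl q (E.flv ∪ v.flv))
  | collapseEnds {E F : Ctx} {G R : STy} {p q : BlameLabel} :
      E.IsEval → F.IsEval → G.Ground → R.Ground → STy.Sub G.dual R →
      Proc.Step
        (.nuChan (.par (.thread (E.fill (.cast (.chan 0) (.sess .dyn) p (.sess G))))
          (.thread (F.fill (.cast (.chan 1) (.sess .dyn) q (.sess R))))))
        (.nuChan (.par (.thread (E.fill (.chan 0))) (.thread (F.fill (.chan 1)))))
  /-- The binder is kept, since both endpoints occur in the result. -/
  | collideEnds {E F : Ctx} {G R : STy} {p q : BlameLabel} :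
      E.IsEval → F.IsEval → G.Ground → R.Ground → ¬ STy.Sub G.dual R →
      Proc.Step
        (.nuChan (.par (.thread (E.fill (.cast (.chan 0) (.sess .dyn) p (.sess G))))
          (.thread (F.fill (.cast (.chan 1) (.sess .dyn) q (.sess R))))))
        (.nuChan (.blameBoth p q (E.flv ∪ F.flv ∪ {.chan 0, .chan 1})))
  | par {P P' Q : Proc} : Proc.Step P P' → Proc.Step (.par P Q) (.par P' Q)
  | nuChan {P Q : Proc} : Proc.Step P Q → Proc.Step (.nuChan P) (.nuChan Q)
  | nuRef {P Q : Proc} : Proc.Step P Q → Proc.Step (.nuRef P) (.nuRef Q)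
  | cong {P P' Q Q' : Proc} :
      Proc.Cong P' P → Proc.Step P Q → Proc.Cong Q Q' → Proc.Step P' Q'
  | expr {E : Ctx} {e f : Expr} : E.IsEval → Expr.Step e f →
      Proc.Step (.thread (E.fill e)) (.thread (E.fill f))

/-- `P ⟶* Q`. -/
def Proc.Steps : Proc → Proc → Prop := Relation.ReflTransGen Proc.Step

/-! ### Run-time errors -/

/-- `e.Subj c`: the subject of `e` is the channel endpoint `c`. -/
inductive Expr.Subj : Expr → ℕ → Prop
  | send (f : Expr) (c : ℕ) : Expr.Subj (.send f (.chan c)) c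
  | recv (c : ℕ) : Expr.Subj (.recv (.chan c)) c
  | select (l : Label) (c : ℕ) : Expr.Subj (.select l (.chan c)) c
  | caseOf (c : ℕ) (I : Finset Label) (br : {l // l ∈ I} → Expr) :
      Expr.Subj (.caseOf (.chan c) I br) c
  | close (c : ℕ) : Expr.Subj (.close (.chan c)) c
  | wait (c : ℕ) : Expr.Subj (.wait (.chan c)) c

/-- `e` on `c` and `f` on `d` agree, `e` being the sending side. -/
inductive AgreeFrom (c d : ℕ) : Expr → Expr → Prop
  | comm (g : Expr) : AgreeFrom c d (.send g (.chan c)) (.recv (.chan d))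
  | choice {j : Label} {I : Finset Label} (br : {l // l ∈ I} → Expr) : j ∈ I →
      AgreeFrom c d (.select j (.chan c)) (.caseOf (.chan d) I br)
  | close : AgreeFrom c d (.close (.chan c)) (.wait (.chan d))

/-- `agree^{c,d}{e,f}`, a relation between the unordered pairs `{c,d}` and `{e,f}`. -/
def Agree (c d : ℕ) (e f : Expr) : Prop :=
  AgreeFrom c d e f ∨ AgreeFrom c d f e ∨ AgreeFrom d c e f ∨ AgreeFrom d c f e

/-- Abstractions, possibly wrapped in casts between function types. -/
inductive Expr.IsAbstraction : Expr → Prop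
  | lam (m : Mult) (e : Expr) : Expr.IsAbstraction (.lam m e)
  | cast {v : Expr} (m n : Mult) (T U T' U' : Ty) (p : BlameLabel) :
      v.IsAbstraction → Expr.IsAbstraction (.cast v (.arrow m T U) p (.arrow n T' U'))

def Expr.IsPair (v : Expr) : Prop := ∃ m e f, v = .pair m e f

def Expr.IsValueOrVar (v : Expr) : Prop := v.IsValue ∨ ∃ x, v = .var x

/-- The four forms of processes that are immediately erroneous. -/
inductive ErrorForm : Proc → Prop
  | app {E : Ctx} {v e : Expr} : E.IsEval → v.IsValueOrVar → ¬ v.IsAbstraction →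
      ErrorForm (.thread (E.fill (.app v e)))
  | letPair {E : Ctx} {v e : Expr} : E.IsEval → v.IsValueOrVar → ¬ v.IsPair →
      ErrorForm (.thread (E.fill (.letPair v e)))
  | share {E F : Ctx} {e f : Expr} {c : ℕ} : E.IsEval → F.IsEval → e.Subj c → f.Subj c →
      ErrorForm (.par (.thread (E.fill e)) (.thread (F.fill f)))
  | disagree {E F : Ctx} {e f : Expr} : E.IsEval → F.IsEval → e.Subj 0 → f.Subj 1 →
      ¬ Agree 0 1 e f →
      ErrorForm (.nuChan (.par (.thread (E.fill e)) (.thread (F.fill f))))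

/-- `Contains P Q`: the process `Q` is a subprocess of `P`. -/
inductive Proc.Contains : Proc → Proc → Prop
  | refl (P : Proc) : Proc.Contains P P
  | parL {P Q R : Proc} : Proc.Contains P R → Proc.Contains (.par P Q) R
  | parR {P Q R : Proc} : Proc.Contains Q R → Proc.Contains (.par P Q) R
  | nuChan {P R : Proc} : Proc.Contains P R → Proc.Contains (.nuChan P) R
  | nuRef {P R : Proc} : Proc.Contains P R → Proc.Contains (.nuRef P) R

/-- A process is an error if it is structurally congruent to a process with an erroneous
subprocess. -/
def Proc.IsError (P : Proc) : Prop :=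
  ∃ P' Q, Proc.Cong P P' ∧ Proc.Contains P' Q ∧ ErrorForm Q

/-- No name has a function type or a pair type in `Γ`. -/
def Env.NoArrowOrProd (Γ : Env) : Prop :=
  ∀ z T, Γ z = some T → (∀ m U V, T ≠ .arrow m U V) ∧ (∀ m U V, T ≠ .prod m U V)

end GGV

/-! Absence of run-time errors in the internal language of Gradual GV, by way of an affine type
system that is preserved by reduction. -/

namespace GGV

/-! ### Subtyping is a preorder -/

-- Every error is a value of the wrong shape, an endpoint held by two threads, or two endpoints used
-- at types that are not dual. None comes from a name that is dropped. So the invariant need not be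
-- linear typing; an affine system suffices, `Has` for expressions and `WT` for processes. There a
-- total environment fixes the types of all names and is never split. Only the set `X` of linear
-- names that may be used is divided among subterms, by `Parts`. Blame and locked references are
-- typed outright, so the name sets carried by blame play no role. Both judgements are recursive on
-- syntax with subsumption built into the expression clauses, which makes inversion immediate.
--
-- Linear typing implies affine typing (`HasType.has`, `Proc.WellTyped.wt`), and affine typing is
-- invariant under structural congruence (`Proc.Cong.wt_iff`) and preserved by reduction
-- (`Proc.Step.preserves`). Three facts carry preservation. A value of unrestricted type uses no
-- linear name (`Has.value_un`), so substitution may duplicate it. A redex can be replaced in its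
-- context while the types of linear names that the context does not own change (`Has.fill_inv`), so
-- a communication may advance the types of its two endpoints. A linear value cast to the dynamic
-- type hands its names to a store, and the access that locks the store hands them back to one
-- thread. Well-formedness of casts matters where a cast of a pair is distributed over the
-- components: the components of an unrestricted result must be unrestricted.
--
-- A typed process has no erroneous subprocess (`ErrorForm.not_wt`). No name has a function or pair
-- type, since `ν` binds names only at session types and the dynamic type; hence values of function
-- type are abstractions and values of pair type are pairs. Parallel threads own disjoint sets of
-- names. The ends of a channel have types `S` and `S.dual`, used up to subtyping, which forces
-- agreement (`SubjAt.agree`).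

mutual
theorem Ty.Sub.refl : ∀ T : Ty, Ty.Sub T T
  | .unit => .unit
  | .sess S => .sess (STy.Sub.refl S)
  | .arrow m T U => .arrow (Ty.Sub.refl T) (Ty.Sub.refl U) (by cases m <;> constructor)
  | .prod m T U => .prod (Ty.Sub.refl T) (Ty.Sub.refl U) (by cases m <;> constructor)
  | .dyn => .dyn
theorem STy.Sub.refl : ∀ S : STy, STy.Sub S S
  | .send T S => .send (Ty.Sub.refl T) (STy.Sub.refl S)
  | .recv T S => .recv (Ty.Sub.refl T) (STy.Sub.refl S)
  | .select _ _ S => .select (Finset.Subset.refl _) fun j hj => STy.Sub.refl (S ⟨j, hj⟩)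
  | .branch _ _ S => .branch (Finset.Subset.refl _) fun j hj => STy.Sub.refl (S ⟨j, hj⟩)
  | .close => .close
  | .wait => .wait
  | .dyn => .dyn
end

theorem Mult.Le.trans {m n k : Mult} (h : m.Le n) (h' : n.Le k) : m.Le k := by
  cases h <;> cases h' <;> constructor

mutual
-- The recursion is on the middle type: contravariance exchanges the two outer types, but the middle
-- one stays in the middle.
theorem Ty.Sub.trans_aux : ∀ U T V : Ty, Ty.Sub T U → Ty.Sub U V → Ty.Sub T V
  | .unit, _, _, h, h' => by cases h; exact h'
  | .sess S, _, _, h, h' => by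
    cases h with | sess h => cases h' with | sess h' => exact .sess (STy.Sub.trans_aux S _ _ h h')
  | .arrow m A B, _, _, h, h' => by
    cases h with | arrow h₁ h₂ h₃ => cases h' with | arrow k₁ k₂ k₃ =>
    exact .arrow (Ty.Sub.trans_aux A _ _ k₁ h₁) (Ty.Sub.trans_aux B _ _ h₂ k₂) (h₃.trans k₃)
  | .prod m A B, _, _, h, h' => by
    cases h with | prod h₁ h₂ h₃ => cases h' with | prod k₁ k₂ k₃ =>
    exact .prod (Ty.Sub.trans_aux A _ _ h₁ k₁) (Ty.Sub.trans_aux B _ _ h₂ k₂) (h₃.trans k₃)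
  | .dyn, _, _, h, h' => by cases h; exact h'
theorem STy.Sub.trans_aux : ∀ U T V : STy, STy.Sub T U → STy.Sub U V → STy.Sub T V
  | .send A S, _, _, h, h' => by
    cases h with | send h₁ h₂ => cases h' with | send k₁ k₂ =>
    exact .send (Ty.Sub.trans_aux A _ _ k₁ h₁) (STy.Sub.trans_aux S _ _ h₂ k₂)
  | .recv A S, _, _, h, h' => by
    cases h with | recv h₁ h₂ => cases h' with | recv k₁ k₂ =>
    exact .recv (Ty.Sub.trans_aux A _ _ h₁ k₁) (STy.Sub.trans_aux S _ _ h₂ k₂)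
  | .select I hI S, _, _, h, h' => by
    cases h with | select h₁ h₂ => cases h' with | select k₁ k₂ =>
    exact .select (k₁.trans h₁) fun j hj =>
      STy.Sub.trans_aux (S ⟨j, k₁ hj⟩) _ _ (h₂ j (k₁ hj)) (k₂ j hj)
  | .branch I hI S, _, _, h, h' => by
    cases h with | branch h₁ h₂ => cases h' with | branch k₁ k₂ =>
    exact .branch (h₁.trans k₁) fun j hj =>
      STy.Sub.trans_aux (S ⟨j, h₁ hj⟩) _ _ (h₂ j hj) (k₂ j (h₁ hj))
  | .close, _, _, h, h' => by cases h; exact h'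
  | .wait, _, _, h, h' => by cases h; exact h'
  | .dyn, _, _, h, h' => by cases h; exact h'
end

theorem Ty.Sub.trans {T U V : Ty} (h : Ty.Sub T U) (h' : Ty.Sub U V) : Ty.Sub T V :=
  Ty.Sub.trans_aux U T V h h'

-- Multiplicities, duality and ground types

theorem Ty.Sub.mult_un {T U : Ty} (h : Ty.Sub T U) (hU : U.mult = .un) : T.mult = .un := by
  cases h with
  | unit => rfl
  | sess => exact hU
  | arrow _ _ h => cases h <;> first | rfl | cases hU
  | prod _ _ h => cases h <;> first | rfl | cases hU
  | dyn => rfl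

theorem Mult.Le.of_un {m n : Mult} (h : n = .un → m = .un) : m.Le n := by
  cases n
  · cases m <;> constructor
  · rw [h rfl]; constructor

theorem Mult.ne_lin {m : Mult} : m ≠ .lin ↔ m = .un := by cases m <;> simp

theorem STy.dual_dual (S : STy) : S.dual.dual = S := by
  induction S using STy.rec (motive_1 := fun _ => True) <;> simp_all [STy.dual]

theorem Ty.Ground.wellFormed {G : Ty} (h : G.Ground) : G.WellFormed := by
  cases h <;> simp [Ty.WellFormed, STy.WellFormed, Ty.mult]

theorem STy.Ground.wellFormed {G : STy} (h : G.Ground) : G.WellFormed := by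
  cases h <;> simp [Ty.WellFormed, STy.WellFormed]

/-! ### Maps on names, extended under binders -/

section Push
variable {α : Type*}

/-- The codomain is arbitrary because the same extension serves environments (`Ty`), sets of usable
names (`Prop`) and the relations between names that go with substitutions (`Name → Prop`). -/
def pushVar (f : Name → α) (a : α) : Name → α
  | .var 0 => a
  | .var (n + 1) => f (.var n)
  | .chan n => f (.chan n)
  | .ref n => f (.ref n)

def pushChan (f : Name → α) (a b : α) : Name → α
  | .chan 0 => a
  | .chan 1 => b
  | .chan (n + 2) => f (.chan n)
  | .var n => f (.var n)
  | .ref n => f (.ref n)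

def pushRef (f : Name → α) (a : α) : Name → α
  | .ref 0 => a
  | .ref (n + 1) => f (.ref n)
  | .var n => f (.var n)
  | .chan n => f (.chan n)

/-- A name in the scope of a binder is either the bound one or a weakened outer one. Together with
the `simp` rules for `pushVar` this replaces case analysis on indices; the versions for channels and
references play the same part. -/
theorem forall_pushVar {p : Name → Prop} :
    (∀ z, p z) ↔ p (.var 0) ∧ (∀ z : Name, p (z.rename .shiftVar)) := by
  refine ⟨fun h => ⟨h _, fun z => h _⟩, fun ⟨h₀, h⟩ => ?_⟩
  rintro ((_ | n) | n | n)
  · exact h₀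
  · exact h (.var n)
  · exact h (.chan _)
  · exact h (.ref _)

theorem forall_pushChan {p : Name → Prop} :
    (∀ z, p z) ↔ p (.chan 0) ∧ p (.chan 1) ∧ (∀ z : Name, p (z.rename .shiftChan)) := by
  refine ⟨fun h => ⟨h _, h _, fun z => h _⟩, fun ⟨h₀, h₁, h⟩ => ?_⟩
  rintro (n | (_ | _ | n) | n)
  · exact h (.var n)
  · exact h₀
  · exact h₁
  · exact h (.chan n)
  · exact h (.ref _)

theorem forall_pushRef {p : Name → Prop} :
    (∀ z, p z) ↔ p (.ref 0) ∧ (∀ z : Name, p (z.rename .shiftRef)) := by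
  refine ⟨fun h => ⟨h _, fun z => h _⟩, fun ⟨h₀, h⟩ => ?_⟩
  rintro (n | n | (_ | n))
  · exact h (.var n)
  · exact h (.chan _)
  · exact h₀
  · exact h (.ref _)

@[simp] theorem pushVar_zero (f : Name → α) (a : α) : pushVar f a (.var 0) = a := rfl
@[simp] theorem pushVar_shift (f : Name → α) (a : α) (z : Name) :
    pushVar f a (z.rename .shiftVar) = f z := by cases z <;> rfl
@[simp] theorem pushChan_zero (f : Name → α) (a b : α) : pushChan f a b (.chan 0) = a := rfl
@[simp] theorem pushChan_one (f : Name → α) (a b : α) : pushChan f a b (.chan 1) = b := rfl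
@[simp] theorem pushChan_shift (f : Name → α) (a b : α) (z : Name) :
    pushChan f a b (z.rename .shiftChan) = f z := by cases z <;> rfl
@[simp] theorem pushRef_zero (f : Name → α) (a : α) : pushRef f a (.ref 0) = a := rfl
@[simp] theorem pushRef_shift (f : Name → α) (a : α) (z : Name) :
    pushRef f a (z.rename .shiftRef) = f z := by cases z <;> rfl

@[simp] theorem liftVar_zero (ρ : Ren) : (Name.var 0).rename ρ.liftVar = .var 0 := rfl
@[simp] theorem liftVar_shift (ρ : Ren) (z : Name) :
    (z.rename .shiftVar).rename ρ.liftVar = (z.rename ρ).rename .shiftVar := by cases z <;> rfl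
@[simp] theorem liftChan_zero (ρ : Ren) : (Name.chan 0).rename ρ.liftChan = .chan 0 := rfl
@[simp] theorem liftChan_one (ρ : Ren) : (Name.chan 1).rename ρ.liftChan = .chan 1 := rfl
@[simp] theorem liftChan_shift (ρ : Ren) (z : Name) :
    (z.rename .shiftChan).rename ρ.liftChan = (z.rename ρ).rename .shiftChan := by cases z <;> rfl
@[simp] theorem liftRef_zero (ρ : Ren) : (Name.ref 0).rename ρ.liftRef = .ref 0 := rfl
@[simp] theorem liftRef_shift (ρ : Ren) (z : Name) :
    (z.rename .shiftRef).rename ρ.liftRef = (z.rename ρ).rename .shiftRef := by cases z <;> rfl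

theorem pushVar_comp_lift (f : Name → α) (a : α) (ρ : Ren) :
    pushVar f a ∘ Name.rename ρ.liftVar = pushVar (f ∘ Name.rename ρ) a :=
  funext (forall_pushVar.2 (by simp))
theorem pushChan_comp_lift (f : Name → α) (a b : α) (ρ : Ren) :
    pushChan f a b ∘ Name.rename ρ.liftChan = pushChan (f ∘ Name.rename ρ) a b :=
  funext (forall_pushChan.2 (by simp))
theorem pushRef_comp_lift (f : Name → α) (a : α) (ρ : Ren) :
    pushRef f a ∘ Name.rename ρ.liftRef = pushRef (f ∘ Name.rename ρ) a :=
  funext (forall_pushRef.2 (by simp))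

end Push

theorem Name.rename_shiftVar_injective : Function.Injective (Name.rename .shiftVar) := by
  rintro (_ | _ | _) (_ | _ | _) h <;> simp_all [Name.rename, Ren.shiftVar]
theorem Name.rename_shiftChan_injective : Function.Injective (Name.rename .shiftChan) := by
  rintro (_ | _ | _) (_ | _ | _) h <;> simp_all [Name.rename, Ren.shiftChan]
theorem Name.rename_shiftRef_injective : Function.Injective (Name.rename .shiftRef) := by
  rintro (_ | _ | _) (_ | _ | _) h <;> simp_all [Name.rename, Ren.shiftRef]

theorem Name.rename_shiftVar_ne (z : Name) : z.rename .shiftVar ≠ .var 0 := by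
  cases z <;> simp [Name.rename, Ren.shiftVar]
theorem Name.rename_shiftChan_ne_zero (z : Name) : z.rename .shiftChan ≠ .chan 0 := by
  cases z <;> simp [Name.rename, Ren.shiftChan]
theorem Name.rename_shiftChan_ne_one (z : Name) : z.rename .shiftChan ≠ .chan 1 := by
  cases z <;> simp [Name.rename, Ren.shiftChan]
theorem Name.rename_shiftRef_ne (z : Name) : z.rename .shiftRef ≠ .ref 0 := by
  cases z <;> simp [Name.rename, Ren.shiftRef]

theorem Name.rename_liftVar_injective {ρ : Ren} (h : Function.Injective (Name.rename ρ)) :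
    Function.Injective (Name.rename ρ.liftVar) := by
  refine forall_pushVar.2 ⟨forall_pushVar.2 ⟨by simp, fun z hz => ?_⟩, fun z =>
    forall_pushVar.2 ⟨fun hz => ?_, fun y hz => ?_⟩⟩
  · exact absurd hz.symm (by simpa using Name.rename_shiftVar_ne _)
  · exact absurd hz (by simpa using Name.rename_shiftVar_ne _)
  · simp only [liftVar_shift] at hz
    rw [h (Name.rename_shiftVar_injective hz)]

theorem Name.rename_liftChan_injective {ρ : Ren} (h : Function.Injective (Name.rename ρ)) :
    Function.Injective (Name.rename ρ.liftChan) := by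
  refine forall_pushChan.2 ⟨forall_pushChan.2 ⟨by simp, by simp, fun z hz => ?_⟩,
    forall_pushChan.2 ⟨by simp, by simp, fun z hz => ?_⟩, fun z =>
    forall_pushChan.2 ⟨fun hz => ?_, fun hz => ?_, fun y hz => ?_⟩⟩
  · exact absurd hz.symm (by simpa using Name.rename_shiftChan_ne_zero _)
  · exact absurd hz.symm (by simpa using Name.rename_shiftChan_ne_one _)
  · exact absurd hz (by simpa using Name.rename_shiftChan_ne_zero _)
  · exact absurd hz (by simpa using Name.rename_shiftChan_ne_one _)
  · simp only [liftChan_shift] at hz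
    rw [h (Name.rename_shiftChan_injective hz)]

theorem Name.rename_liftRef_injective {ρ : Ren} (h : Function.Injective (Name.rename ρ)) :
    Function.Injective (Name.rename ρ.liftRef) := by
  refine forall_pushRef.2 ⟨forall_pushRef.2 ⟨by simp, fun z hz => ?_⟩, fun z =>
    forall_pushRef.2 ⟨fun hz => ?_, fun y hz => ?_⟩⟩
  · exact absurd hz.symm (by simpa using Name.rename_shiftRef_ne _)
  · exact absurd hz (by simpa using Name.rename_shiftRef_ne _)
  · simp only [liftRef_shift] at hz
    rw [h (Name.rename_shiftRef_injective hz)]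

/-! ### Affine typing of expressions -/

/-- `X₁` and `X₂` are disjoint parts of `X`. -/
def Parts (X X₁ X₂ : Name → Prop) : Prop :=
  ∀ z, (X₁ z → X z) ∧ (X₂ z → X z) ∧ ¬ (X₁ z ∧ X₂ z)

/-- Affine typing: the types of all names are given by `Γ`, and `X` holds the names of linear type
that may be used. Subsumption is built in, and the types in casts are well formed. -/
def Has : Expr → (Name → Ty) → (Name → Prop) → Ty → Prop
  -- Permission is asked for linear names only, so it does not matter which unrestricted names lie
  -- in `X`.
  | .name z, Γ, X, T => Ty.Sub (Γ z) T ∧ ((Γ z).mult = .lin → X z)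
  | .unit, _, _, T => Ty.Sub .unit T
  -- `Y` is the set of captured linear names. It is empty for an unrestricted function, which may
  -- therefore be copied.
  | .lam m e, Γ, X, T => ∃ A B Y, (∀ z, Y z → X z) ∧ (m = .un → ∀ z, ¬ Y z) ∧
      Has e (pushVar Γ A) (pushVar Y True) B ∧ Ty.Sub (.arrow m A B) T
  | .app e f, Γ, X, T => ∃ m A B X₁ X₂, Parts X X₁ X₂ ∧ Has e Γ X₁ (.arrow m A B) ∧ Has f Γ X₂ A ∧
      Ty.Sub B T
  | .pair m e f, Γ, X, T => ∃ A B X₁ X₂, Parts X X₁ X₂ ∧ Has e Γ X₁ A ∧ Has f Γ X₂ B ∧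
      Mult.Le A.mult m ∧ Mult.Le B.mult m ∧ Ty.Sub (.prod m A B) T
  | .letPair e f, Γ, X, T => ∃ m A B U X₁ X₂, Parts X X₁ X₂ ∧ Has e Γ X₁ (.prod m A B) ∧
      Has f (pushVar (pushVar Γ A) B) (pushVar (pushVar X₂ True) True) U ∧ Ty.Sub U T
  | .fork e, Γ, X, T => Has e Γ X .unit ∧ Ty.Sub .unit T
  | .new, _, _, T => ∃ S : STy, Ty.Sub (.prod .lin (.sess S) (.sess S.dual)) T
  | .send e f, Γ, X, T => ∃ A S X₁ X₂, Parts X X₁ X₂ ∧ Has e Γ X₁ A ∧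
      Has f Γ X₂ (.sess (.send A S)) ∧ Ty.Sub (.sess S) T
  | .recv e, Γ, X, T => ∃ A S, Has e Γ X (.sess (.recv A S)) ∧ Ty.Sub (.prod .lin A (.sess S)) T
  | .select l e, Γ, X, T => ∃ I hI, ∃ S : {l // l ∈ I} → STy, ∃ hl : l ∈ I,
      Has e Γ X (.sess (.select I hI S)) ∧ Ty.Sub (.sess (S ⟨l, hl⟩)) T
  | .caseOf e I br, Γ, X, T => ∃ hI, ∃ S : {l // l ∈ I} → STy, ∃ U X₁ X₂, Parts X X₁ X₂ ∧
      Has e Γ X₁ (.sess (.branch I hI S)) ∧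
      (∀ i, Has (br i) (pushVar Γ (.sess (S i))) (pushVar X₂ True) U) ∧ Ty.Sub U T
  | .close e, Γ, X, T => Has e Γ X (.sess .close) ∧ Ty.Sub .unit T
  | .wait e, Γ, X, T => Has e Γ X (.sess .wait) ∧ Ty.Sub .unit T
  | .cast e A _ B, Γ, X, T => Has e Γ X A ∧ Ty.CSub A B ∧ A.WellFormed ∧ B.WellFormed ∧ Ty.Sub B T

/-- Each clause ends in a subtyping to the type assigned, so subsumption is transitivity. -/
theorem Has.sub {e : Expr} {Γ X T U} (h : Has e Γ X T) (hs : Ty.Sub T U) : Has e Γ X U := by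
  cases e
  case caseOf e I br =>
    obtain ⟨hI, S, V, X₁, X₂, hX, he, hb, hV⟩ := h
    exact ⟨hI, S, V, X₁, X₂, hX, he, hb, hV.trans hs⟩
  all_goals simp only [Has] at h ⊢; grind [Ty.Sub.trans]

theorem Parts.mono {X X' X₁ X₂ : Name → Prop} (h : Parts X X₁ X₂) (hX : ∀ z, X z → X' z) :
    Parts X' X₁ X₂ := fun z => ⟨fun h₁ => hX z ((h z).1 h₁), fun h₂ => hX z ((h z).2.1 h₂), (h z).2.2⟩

theorem Parts.left {X X₁ X₂ : Name → Prop} (h : Parts X X₁ X₂) {z : Name} (hz : X₁ z) : X z :=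
  (h z).1 hz

theorem Parts.right {X X₁ X₂ : Name → Prop} (h : Parts X X₁ X₂) {z : Name} (hz : X₂ z) : X z :=
  (h z).2.1 hz

/-- The environments `Γ` and `Γ'` have the same type for each name that `X` allows to use. -/
def AgreeOn (X : Name → Prop) (Γ Γ' : Name → Ty) : Prop :=
  ∀ z, X z ∨ (Γ z).mult = .un → Γ' z = Γ z

theorem AgreeOn.refl (X : Name → Prop) (Γ : Name → Ty) : AgreeOn X Γ Γ := fun _ _ => rfl

theorem AgreeOn.anti {X X' : Name → Prop} {Γ Γ' : Name → Ty} (h : AgreeOn X Γ Γ')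
    (hX : ∀ z, X' z → X z) : AgreeOn X' Γ Γ' := fun z hz => h z (hz.imp_left (hX z))

theorem AgreeOn.push {X : Name → Prop} {Γ Γ' : Name → Ty} (h : AgreeOn X Γ Γ') (T : Ty) :
    AgreeOn (pushVar X True) (pushVar Γ T) (pushVar Γ' T) :=
  forall_pushVar.2 ⟨by simp, fun z => by simpa using h z⟩

theorem pushVar_mono {X X' : Name → Prop} (h : ∀ z, X z → X' z) (p : Prop) :
    ∀ z, pushVar X p z → pushVar X' p z :=
  forall_pushVar.2 ⟨id, fun z => by simpa using h z⟩

/-- A linear name outside `X` cannot be used, so its type is immaterial. This is what later allows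
the type of an endpoint to change without disturbing the terms that do not own it. -/
theorem Has.mono {e : Expr} : ∀ {Γ Γ' : Name → Ty} {X X' : Name → Prop} {T : Ty},
    Has e Γ X T → (∀ z, X z → X' z) → AgreeOn X Γ Γ' → Has e Γ' X' T := by
  induction e with
  | name z =>
    rintro Γ Γ' X X' T ⟨h, hz⟩ hX hΓ
    have : Γ' z = Γ z := hΓ z (by
      by_cases hl : (Γ z).mult = .lin
      · exact .inl (hz hl)
      · exact .inr (Mult.ne_lin.1 hl))
    exact ⟨this ▸ h, this ▸ fun hl => hX z (hz hl)⟩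
  | unit => intro _ _ _ _ _ h _ _; exact h
  | lam m e ih =>
    rintro Γ Γ' X X' T ⟨A, B, Y, hY, hm, he, hT⟩ hX hΓ
    exact ⟨A, B, Y, fun z hz => hX z (hY z hz), hm, ih he (fun _ => id) ((hΓ.anti hY).push A), hT⟩
  | app e f ihe ihf =>
    rintro Γ Γ' X X' T ⟨m, A, B, X₁, X₂, hp, he, hf, hT⟩ hX hΓ
    exact ⟨m, A, B, X₁, X₂, hp.mono hX, ihe he (fun _ => id) (hΓ.anti fun _ => hp.left),
      ihf hf (fun _ => id) (hΓ.anti fun _ => hp.right), hT⟩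
  | pair m e f ihe ihf =>
    rintro Γ Γ' X X' T ⟨A, B, X₁, X₂, hp, he, hf, hT⟩ hX hΓ
    exact ⟨A, B, X₁, X₂, hp.mono hX, ihe he (fun _ => id) (hΓ.anti fun _ => hp.left),
      ihf hf (fun _ => id) (hΓ.anti fun _ => hp.right), hT⟩
  | letPair e f ihe ihf =>
    rintro Γ Γ' X X' T ⟨m, A, B, U, X₁, X₂, hp, he, hf, hT⟩ hX hΓ
    exact ⟨m, A, B, U, X₁, X₂, hp.mono hX, ihe he (fun _ => id) (hΓ.anti fun _ => hp.left),
      ihf hf (fun _ => id) (((hΓ.anti fun _ => hp.right).push A).push B), hT⟩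
  | fork e ih => rintro Γ Γ' X X' T ⟨he, hT⟩ hX hΓ; exact ⟨ih he hX hΓ, hT⟩
  | new => intro _ _ _ _ _ h _ _; exact h
  | send e f ihe ihf =>
    rintro Γ Γ' X X' T ⟨A, S, X₁, X₂, hp, he, hf, hT⟩ hX hΓ
    exact ⟨A, S, X₁, X₂, hp.mono hX, ihe he (fun _ => id) (hΓ.anti fun _ => hp.left),
      ihf hf (fun _ => id) (hΓ.anti fun _ => hp.right), hT⟩
  | recv e ih =>
    rintro Γ Γ' X X' T ⟨A, S, he, hT⟩ hX hΓ
    exact ⟨A, S, ih he hX hΓ, hT⟩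
  | select l e ih =>
    rintro Γ Γ' X X' T ⟨I, hI, S, hl, he, hT⟩ hX hΓ
    exact ⟨I, hI, S, hl, ih he hX hΓ, hT⟩
  | caseOf e I br ihe ihb =>
    rintro Γ Γ' X X' T ⟨hI, S, U, X₁, X₂, hp, he, hb, hT⟩ hX hΓ
    exact ⟨hI, S, U, X₁, X₂, hp.mono hX, ihe he (fun _ => id) (hΓ.anti fun _ => hp.left),
      fun i => ihb i (hb i) (fun _ => id) ((hΓ.anti fun _ => hp.right).push _), hT⟩
  | close e ih => rintro Γ Γ' X X' T ⟨he, hT⟩ hX hΓ; exact ⟨ih he hX hΓ, hT⟩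
  | wait e ih => rintro Γ Γ' X X' T ⟨he, hT⟩ hX hΓ; exact ⟨ih he hX hΓ, hT⟩
  | cast e A p B ih => rintro Γ Γ' X X' T ⟨he, hT⟩ hX hΓ; exact ⟨ih he hX hΓ, hT⟩

theorem Has.weaken {e : Expr} {Γ X X' T} (h : Has e Γ X T) (hX : ∀ z, X z → X' z) :
    Has e Γ X' T := h.mono hX (.refl _ _)

/-! ### Renaming -/

/-- Injectivity is not needed in this direction: preimages of disjoint sets are disjoint. -/
theorem Has.of_rename {e : Expr} : ∀ {ρ : Ren} {Γ : Name → Ty} {X : Name → Prop} {T : Ty},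
    Has (e.rename ρ) Γ X T → Has e (Γ ∘ Name.rename ρ) (X ∘ Name.rename ρ) T := by
  have hp {ρ : Ren} {X X₁ X₂} (h : Parts X X₁ X₂) :
      Parts (X ∘ Name.rename ρ) (X₁ ∘ Name.rename ρ) (X₂ ∘ Name.rename ρ) := fun z => h _
  induction e with
  | name z => intro _ _ _ _ h; exact h
  | unit => intro _ _ _ _ h; exact h
  | lam m e ih =>
    rintro ρ Γ X T ⟨A, B, Y, hY, hm, he, hT⟩
    refine ⟨A, B, Y ∘ Name.rename ρ, fun z => hY _, fun h z => hm h _, ?_, hT⟩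
    simpa only [pushVar_comp_lift] using ih he
  | app e f ihe ihf =>
    rintro ρ Γ X T ⟨m, A, B, X₁, X₂, h, he, hf, hT⟩
    exact ⟨m, A, B, _, _, hp h, ihe he, ihf hf, hT⟩
  | pair m e f ihe ihf =>
    rintro ρ Γ X T ⟨A, B, X₁, X₂, h, he, hf, hT⟩
    exact ⟨A, B, _, _, hp h, ihe he, ihf hf, hT⟩
  | letPair e f ihe ihf =>
    rintro ρ Γ X T ⟨m, A, B, U, X₁, X₂, h, he, hf, hT⟩
    refine ⟨m, A, B, U, _, _, hp h, ihe he, ?_, hT⟩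
    simpa only [pushVar_comp_lift] using ihf hf
  | fork e ih => rintro ρ Γ X T ⟨he, hT⟩; exact ⟨ih he, hT⟩
  | new => intro _ _ _ _ h; exact h
  | send e f ihe ihf =>
    rintro ρ Γ X T ⟨A, S, X₁, X₂, h, he, hf, hT⟩
    exact ⟨A, S, _, _, hp h, ihe he, ihf hf, hT⟩
  | recv e ih =>
    rintro ρ Γ X T ⟨A, S, he, hT⟩
    exact ⟨A, S, ih he, hT⟩
  | select l e ih =>
    rintro ρ Γ X T ⟨I, hI, S, hl, he, hT⟩
    exact ⟨I, hI, S, hl, ih he, hT⟩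
  | caseOf e I br ihe ihb =>
    rintro ρ Γ X T ⟨hI, S, U, X₁, X₂, h, he, hb, hT⟩
    refine ⟨hI, S, U, _, _, hp h, ihe he, fun i => ?_, hT⟩
    simpa only [pushVar_comp_lift] using ihb i (hb i)
  | close e ih => rintro ρ Γ X T ⟨he, hT⟩; exact ⟨ih he, hT⟩
  | wait e ih => rintro ρ Γ X T ⟨he, hT⟩; exact ⟨ih he, hT⟩
  | cast e A p B ih => rintro ρ Γ X T ⟨he, hT⟩; exact ⟨ih he, hT⟩

/-- The image of a set of names under a renaming. -/
def imageRen (ρ : Ren) (X : Name → Prop) : Name → Prop := fun y => ∃ z, z.rename ρ = y ∧ X z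

theorem imageRen_apply {ρ : Ren} {X : Name → Prop} {z : Name} (h : X z) :
    imageRen ρ X (z.rename ρ) := ⟨z, rfl, h⟩

theorem Parts.image {ρ : Ren} (hρ : Function.Injective (Name.rename ρ)) {X X' X₁ X₂ : Name → Prop}
    (h : Parts X X₁ X₂) (hX : ∀ z, X z → X' (z.rename ρ)) :
    Parts X' (imageRen ρ X₁) (imageRen ρ X₂) := by
  refine fun y => ⟨?_, ?_, ?_⟩
  · rintro ⟨z, rfl, hz⟩; exact hX z (h.left hz)
  · rintro ⟨z, rfl, hz⟩; exact hX z (h.right hz)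
  · rintro ⟨⟨z, rfl, hz⟩, ⟨z', hz', hz''⟩⟩
    exact (h z).2.2 ⟨hz, hρ hz' ▸ hz''⟩

/-- The relation `r` is equality when `f` is an environment and implication when `f` is a set of
usable names. -/
theorem pushVar_lift {α : Type*} {ρ : Ren} {f f' : Name → α} (a : α) {r : α → α → Prop}
    (ha : r a a) (h : ∀ z, r (f z) (f' (z.rename ρ))) :
    ∀ z, r (pushVar f a z) (pushVar f' a (z.rename ρ.liftVar)) :=
  forall_pushVar.2 ⟨ha, fun z => by simpa using h z⟩

theorem pushChan_lift {α : Type*} {ρ : Ren} {f f' : Name → α} (a b : α) {r : α → α → Prop}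
    (ha : r a a) (hb : r b b) (h : ∀ z, r (f z) (f' (z.rename ρ))) :
    ∀ z, r (pushChan f a b z) (pushChan f' a b (z.rename ρ.liftChan)) :=
  forall_pushChan.2 ⟨ha, hb, fun z => by simpa using h z⟩

theorem pushRef_lift {α : Type*} {ρ : Ren} {f f' : Name → α} (a : α) {r : α → α → Prop}
    (ha : r a a) (h : ∀ z, r (f z) (f' (z.rename ρ))) :
    ∀ z, r (pushRef f a z) (pushRef f' a (z.rename ρ.liftRef)) :=
  forall_pushRef.2 ⟨ha, fun z => by simpa using h z⟩

/-- Injectivity keeps the images of disjoint sets of names disjoint. -/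
theorem Has.rename {e : Expr} : ∀ {ρ : Ren} {Γ Γ' : Name → Ty} {X X' : Name → Prop} {T : Ty},
    Has e Γ X T → Function.Injective (Name.rename ρ) → (∀ z, Γ z = Γ' (z.rename ρ)) →
    (∀ z, X z → X' (z.rename ρ)) → Has (e.rename ρ) Γ' X' T := by
  have hi {ρ : Ren} (X : Name → Prop) : ∀ z, X z → imageRen ρ X (z.rename ρ) :=
    fun z => imageRen_apply
  have push {ρ : Ren} {X X' : Name → Prop} (h : ∀ z, X z → X' (z.rename ρ)) :
      ∀ z, pushVar X True z → pushVar X' True (z.rename ρ.liftVar) :=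
    pushVar_lift (r := fun a b => a → b) True id h
  have pushT {ρ : Ren} {Γ Γ' : Name → Ty} (A : Ty) (h : ∀ z, Γ z = Γ' (z.rename ρ)) :
      ∀ z, pushVar Γ A z = pushVar Γ' A (z.rename ρ.liftVar) := pushVar_lift A rfl h
  induction e with
  | name z =>
    rintro ρ Γ Γ' X X' T ⟨hT, hz⟩ hρ hΓ hX
    exact ⟨hΓ z ▸ hT, fun hl => hX z (hz (hΓ z ▸ hl))⟩
  | unit => intro _ _ _ _ _ _ h _ _ _; exact h
  | lam m e ih =>
    rintro ρ Γ Γ' X X' T ⟨A, B, Y, hY, hm, he, hT⟩ hρ hΓ hX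
    refine ⟨A, B, imageRen ρ Y, ?_, ?_, ih he (Name.rename_liftVar_injective hρ) (pushT A hΓ)
      (push (hi Y)), hT⟩
    · rintro _ ⟨z, rfl, hz⟩; exact hX z (hY z hz)
    · rintro h _ ⟨z, rfl, hz⟩; exact hm h z hz
  | app e f ihe ihf =>
    rintro ρ Γ Γ' X X' T ⟨m, A, B, X₁, X₂, h, he, hf, hT⟩ hρ hΓ hX
    exact ⟨m, A, B, _, _, h.image hρ hX, ihe he hρ hΓ (hi _), ihf hf hρ hΓ (hi _), hT⟩
  | pair m e f ihe ihf =>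
    rintro ρ Γ Γ' X X' T ⟨A, B, X₁, X₂, h, he, hf, hT⟩ hρ hΓ hX
    exact ⟨A, B, _, _, h.image hρ hX, ihe he hρ hΓ (hi _), ihf hf hρ hΓ (hi _), hT⟩
  | letPair e f ihe ihf =>
    rintro ρ Γ Γ' X X' T ⟨m, A, B, U, X₁, X₂, h, he, hf, hT⟩ hρ hΓ hX
    exact ⟨m, A, B, U, _, _, h.image hρ hX, ihe he hρ hΓ (hi _),
      ihf hf (Name.rename_liftVar_injective (Name.rename_liftVar_injective hρ))
        (pushT B (pushT A hΓ)) (push (push (hi _))), hT⟩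
  | fork e ih => rintro ρ Γ Γ' X X' T ⟨he, hT⟩ hρ hΓ hX; exact ⟨ih he hρ hΓ hX, hT⟩
  | new => intro _ _ _ _ _ _ h _ _ _; exact h
  | send e f ihe ihf =>
    rintro ρ Γ Γ' X X' T ⟨A, S, X₁, X₂, h, he, hf, hT⟩ hρ hΓ hX
    exact ⟨A, S, _, _, h.image hρ hX, ihe he hρ hΓ (hi _), ihf hf hρ hΓ (hi _), hT⟩
  | recv e ih =>
    rintro ρ Γ Γ' X X' T ⟨A, S, he, hT⟩ hρ hΓ hX
    exact ⟨A, S, ih he hρ hΓ hX, hT⟩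
  | select l e ih =>
    rintro ρ Γ Γ' X X' T ⟨I, hI, S, hl, he, hT⟩ hρ hΓ hX
    exact ⟨I, hI, S, hl, ih he hρ hΓ hX, hT⟩
  | caseOf e I br ihe ihb =>
    rintro ρ Γ Γ' X X' T ⟨hI, S, U, X₁, X₂, h, he, hb, hT⟩ hρ hΓ hX
    exact ⟨hI, S, U, _, _, h.image hρ hX, ihe he hρ hΓ (hi _), fun i =>
      ihb i (hb i) (Name.rename_liftVar_injective hρ) (pushT _ hΓ) (push (hi _)), hT⟩
  | close e ih => rintro ρ Γ Γ' X X' T ⟨he, hT⟩ hρ hΓ hX; exact ⟨ih he hρ hΓ hX, hT⟩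
  | wait e ih => rintro ρ Γ Γ' X X' T ⟨he, hT⟩ hρ hΓ hX; exact ⟨ih he hρ hΓ hX, hT⟩
  | cast e A p B ih => rintro ρ Γ Γ' X X' T ⟨he, hT⟩ hρ hΓ hX; exact ⟨ih he hρ hΓ hX, hT⟩

/-! ### Values of unrestricted type -/

/-- The key to duplicating values. Since `un` is the least multiplicity, it passes from a type to
its subtypes, from a pair to its components, and from the target of a function cast to its source. A
cast into the dynamic type is a value only if its ground type is unrestricted; the linear case is
not a value but allocates a store. -/
theorem Has.value_un {v : Expr} (hv : v.IsValue) : ∀ {Γ X T}, Has v Γ X T → T.mult = .un →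
    Has v Γ (fun _ => False) T := by
  have hle {A : Ty} {m : Mult} (h : A.mult.Le m) (hm : m = .un) : A.mult = .un := by
    subst hm
    generalize A.mult = n at h
    cases h
    rfl
  induction hv with
  | unit => intro Γ X T h _; exact h
  | lam m e =>
    rintro Γ X T ⟨A, B, Y, hY, hm, he, hT⟩ hu
    exact ⟨A, B, Y, hm (hT.mult_un hu), hm, he, hT⟩
  | pair m _ _ ihv ihw =>
    rintro Γ X T ⟨A, B, X₁, X₂, hp, he, hf, hA, hB, hT⟩ hu
    have hm : m = .un := hT.mult_un hu
    exact ⟨A, B, _, _, fun z => ⟨id, id, fun h => h.1⟩, ihv he (hle hA hm), ihw hf (hle hB hm),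
      hA, hB, hT⟩
  | chan c =>
    rintro Γ X T ⟨hT, hX⟩ hu
    exact ⟨hT, fun hl => by simp [hT.mult_un hu] at hl⟩
  | ref c =>
    rintro Γ X T ⟨hT, hX⟩ hu
    exact ⟨hT, fun hl => by simp [hT.mult_un hu] at hl⟩
  | castDyn p _ hG hm ih =>
    rintro Γ X T ⟨he, h⟩ hu
    exact ⟨ih he hm, h⟩
  | castSDyn p _ hG ih =>
    rintro Γ X T ⟨he, _, _, _, h⟩ hu
    cases h.mult_un hu
  | castArrow m n A B A' B' p _ ih =>
    rintro Γ X T ⟨he, hc, hA, hB, h⟩ hu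
    have hn : n = .un := h.mult_un hu
    subst hn
    cases hc with | arrow _ _ hm =>
    cases hm
    exact ⟨ih he rfl, .arrow ‹_› ‹_› .un_un, hA, hB, h⟩
  | castSess p _ _ _ ih =>
    rintro Γ X T ⟨he, _, _, _, h⟩ hu
    cases h.mult_un hu

/-! ### Substitution -/

/-- The image of a name under a substitution for variables. -/
def substName (σ : ℕ → Expr) : Name → Expr
  | .var n => σ n
  | .chan n => .chan n
  | .ref n => .ref n

/-- The substitution `σ` takes names typed by `Γ` to expressions typed by `Γ'`. The expression for
the name `z` uses the names in `R z`, and only if `z` is linear. -/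
structure SubstTyped (σ : ℕ → Expr) (Γ : Name → Ty) (X : Name → Prop) (Γ' : Name → Ty)
    (X' : Name → Prop) (R : Name → Name → Prop) : Prop where
  typed : ∀ z, ((Γ z).mult = .lin → X z) →
    Has (substName σ z) Γ' (fun y => (Γ z).mult = .lin ∧ R z y) (Γ z)
  disj : ∀ z z', X z → X z' → ∀ y, R z y → R z' y → z = z'
  incl : ∀ z, X z → ∀ y, R z y → X' y

theorem substName_liftSubst (σ : ℕ → Expr) (z : Name) :
    substName (liftSubst σ) (z.rename .shiftVar) = (substName σ z).rename .shiftVar := by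
  cases z <;> rfl

/-- The bound variable is sent to itself and uses only itself; the images of the outer names are
weakened and so avoid it. -/
theorem SubstTyped.lift {σ Γ X Γ' X' R} (h : SubstTyped σ Γ X Γ' X' R) (A : Ty) :
    SubstTyped (liftSubst σ) (pushVar Γ A) (pushVar X True) (pushVar Γ' A) (pushVar X' True)
      (pushVar (fun z => pushVar (R z) False) (· = .var 0)) where
  typed := by
    refine forall_pushVar.2 ⟨fun _ => ⟨.refl _, fun hl => ⟨hl, rfl⟩⟩, fun z hz => ?_⟩
    rw [substName_liftSubst]
    simp only [pushVar_shift] at hz ⊢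
    exact (h.typed z hz).rename Name.rename_shiftVar_injective (by simp) (by simp)
  disj := by
    refine forall_pushVar.2 ⟨forall_pushVar.2 ⟨fun _ _ _ _ _ => rfl, fun z _ _ => ?_⟩, fun z =>
      forall_pushVar.2 ⟨fun _ _ => ?_, fun z' hz hz' => ?_⟩⟩
    · simp
    · intro y hy hy'
      simp only [pushVar_zero] at hy'
      simp [hy'] at hy
    · refine forall_pushVar.2 ⟨by simp, fun y hy hy' => ?_⟩
      simp only [pushVar_shift] at hz hz' hy hy'
      rw [h.disj z z' hz hz' y hy hy']
  incl := by
    refine forall_pushVar.2 ⟨by simp, fun z hz => forall_pushVar.2 ⟨by simp, ?_⟩⟩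
    simpa using h.incl z (by simpa using hz)

theorem SubstTyped.restrict {σ Γ X Γ' X' R} (h : SubstTyped σ Γ X Γ' X' R) {Y : Name → Prop}
    (hY : ∀ z, Y z → X z) : SubstTyped σ Γ Y Γ' (fun y => ∃ z, Y z ∧ R z y) R where
  typed z hz := h.typed z fun hl => hY z (hz hl)
  disj z z' hz hz' := h.disj z z' (hY z hz) (hY z' hz')
  incl z hz _ hy := ⟨z, hz, hy⟩

/-- A name used by images from both parts would, by `disj`, have a single source, lying in both
parts. -/
theorem SubstTyped.parts {σ Γ X Γ' X' R} (h : SubstTyped σ Γ X Γ' X' R) {X₁ X₂ : Name → Prop}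
    (hp : Parts X X₁ X₂) :
    Parts X' (fun y => ∃ z, X₁ z ∧ R z y) (fun y => ∃ z, X₂ z ∧ R z y) := by
  refine fun y => ⟨?_, ?_, ?_⟩
  · rintro ⟨z, hz, hy⟩; exact h.incl z (hp.left hz) y hy
  · rintro ⟨z, hz, hy⟩; exact h.incl z (hp.right hz) y hy
  · rintro ⟨⟨z, hz, hy⟩, ⟨z', hz', hy'⟩⟩
    obtain rfl := h.disj z z' (hp.left hz) (hp.right hz') y hy hy'
    exact (hp z).2.2 ⟨hz, hz'⟩

/-- At every split the usable names of a subterm become those related by `R` to its part. For an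
unrestricted function the part is empty, hence so is its image. -/
theorem Has.subst {e : Expr} : ∀ {σ Γ X Γ' X' R T}, Has e Γ X T → SubstTyped σ Γ X Γ' X' R →
    Has (e.subst σ) Γ' X' T := by
  induction e with
  | name z =>
    rintro σ Γ X Γ' X' R T ⟨hT, hz⟩ h
    have key := ((h.typed z hz).sub hT).weaken fun y hy => h.incl z (hz hy.1) y hy.2
    cases z <;> exact key
  | unit => intro _ _ _ _ _ _ _ h _; exact h
  | lam m e ih =>
    rintro σ Γ X Γ' X' R T ⟨A, B, Y, hY, hm, he, hT⟩ h
    refine ⟨A, B, _, ?_, ?_, ih he ((h.restrict hY).lift A), hT⟩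
    · rintro y ⟨z, hz, hy⟩; exact h.incl z (hY z hz) y hy
    · rintro hu y ⟨z, hz, hy⟩; exact hm hu z hz
  | app e f ihe ihf =>
    rintro σ Γ X Γ' X' R T ⟨m, A, B, X₁, X₂, hp, he, hf, hT⟩ h
    exact ⟨m, A, B, _, _, h.parts hp, ihe he (h.restrict fun _ => hp.left),
      ihf hf (h.restrict fun _ => hp.right), hT⟩
  | pair m e f ihe ihf =>
    rintro σ Γ X Γ' X' R T ⟨A, B, X₁, X₂, hp, he, hf, hT⟩ h
    exact ⟨A, B, _, _, h.parts hp, ihe he (h.restrict fun _ => hp.left),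
      ihf hf (h.restrict fun _ => hp.right), hT⟩
  | letPair e f ihe ihf =>
    rintro σ Γ X Γ' X' R T ⟨m, A, B, U, X₁, X₂, hp, he, hf, hT⟩ h
    exact ⟨m, A, B, U, _, _, h.parts hp, ihe he (h.restrict fun _ => hp.left),
      ihf hf (((h.restrict fun _ => hp.right).lift A).lift B), hT⟩
  | fork e ih => rintro σ Γ X Γ' X' R T ⟨he, hT⟩ h; exact ⟨ih he h, hT⟩
  | new => intro _ _ _ _ _ _ _ h _; exact h
  | send e f ihe ihf =>
    rintro σ Γ X Γ' X' R T ⟨A, S, X₁, X₂, hp, he, hf, hT⟩ h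
    exact ⟨A, S, _, _, h.parts hp, ihe he (h.restrict fun _ => hp.left),
      ihf hf (h.restrict fun _ => hp.right), hT⟩
  | recv e ih =>
    rintro σ Γ X Γ' X' R T ⟨A, S, he, hT⟩ h
    exact ⟨A, S, ih he h, hT⟩
  | select l e ih =>
    rintro σ Γ X Γ' X' R T ⟨I, hI, S, hl, he, hT⟩ h
    exact ⟨I, hI, S, hl, ih he h, hT⟩
  | caseOf e I br ihe ihb =>
    rintro σ Γ X Γ' X' R T ⟨hI, S, U, X₁, X₂, hp, he, hb, hT⟩ h
    exact ⟨hI, S, U, _, _, h.parts hp, ihe he (h.restrict fun _ => hp.left),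
      fun i => ihb i (hb i) ((h.restrict fun _ => hp.right).lift _), hT⟩
  | close e ih => rintro σ Γ X Γ' X' R T ⟨he, hT⟩ h; exact ⟨ih he h, hT⟩
  | wait e ih => rintro σ Γ X Γ' X' R T ⟨he, hT⟩ h; exact ⟨ih he h, hT⟩
  | cast e A p B ih => rintro σ Γ X Γ' X' R T ⟨he, hT⟩ h; exact ⟨ih he h, hT⟩

/-- The substitution `σ` extended by `v` for the variable `0`. -/
def consSubst (v : Expr) (σ : ℕ → Expr) : ℕ → Expr
  | 0 => v
  | n + 1 => σ n

theorem substName_consSubst (v : Expr) (σ : ℕ → Expr) (z : Name) :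
    substName (consSubst v σ) (z.rename .shiftVar) = substName σ z := by cases z <;> rfl

theorem SubstTyped.id (Γ : Name → Ty) (X : Name → Prop) :
    SubstTyped Expr.var Γ X Γ X (fun z y => y = z) where
  typed z _ := by cases z <;> exact ⟨.refl _, fun hl => ⟨hl, rfl⟩⟩
  disj z z' _ _ y hy hy' := hy.symm.trans hy'
  incl z hz y hy := hy ▸ hz

/-- If `A` is linear, the value brings its names `X₂` and they are charged to the new variable. If
`A` is unrestricted, the value must be typed with no names at all, which is `Has.value_un`. -/
theorem SubstTyped.cons {σ Γ X Γ' X₁ X₂ X' R v A} (h : SubstTyped σ Γ X Γ' X₁ R)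
    (hp : Parts X' X₁ X₂) (hv : v.IsValue) (ht : Has v Γ' X₂ A) :
    SubstTyped (consSubst v σ) (pushVar Γ A) (pushVar X True) Γ' X' (pushVar R X₂) where
  typed := by
    refine forall_pushVar.2 ⟨fun _ => ?_, fun z => ?_⟩
    · cases hA : A.mult
      · exact ht.weaken fun y hy => ⟨hA, hy⟩
      · exact (ht.value_un hv hA).weaken (by simp)
    · rw [substName_consSubst]
      simpa using h.typed z
  disj := by
    refine forall_pushVar.2 ⟨forall_pushVar.2 ⟨fun _ _ _ _ _ => rfl, fun z _ hz y hy hy' => ?_⟩,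
      fun z => forall_pushVar.2 ⟨fun hz _ y hy hy' => ?_, fun z' hz hz' y hy hy' => ?_⟩⟩
    · simp only [pushVar_shift, pushVar_zero] at hz hy hy'
      exact absurd ⟨h.incl z hz y hy', hy⟩ (hp y).2.2
    · simp only [pushVar_shift, pushVar_zero] at hz hy hy'
      exact absurd ⟨h.incl z hz y hy, hy'⟩ (hp y).2.2
    · simp only [pushVar_shift] at hz hz' hy hy'
      rw [h.disj z z' hz hz' y hy hy']
  incl := by
    refine forall_pushVar.2 ⟨fun _ y hy => hp.right hy, fun z hz y hy => ?_⟩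
    simp only [pushVar_shift] at hz hy
    exact hp.left (h.incl z hz y hy)

theorem Has.inst {e v : Expr} {Γ X X₁ X₂ A B} (he : Has e (pushVar Γ A) (pushVar X₁ True) B)
    (hp : Parts X X₁ X₂) (hv : v.IsValue) (ht : Has v Γ X₂ A) : Has (e.inst v) Γ X B := by
  have hσ : e.inst v = e.subst (consSubst v .var) := by
    unfold Expr.inst
    congr 1
  exact hσ ▸ he.subst ((SubstTyped.id Γ X₁).cons hp hv ht)

theorem Has.instPair {e v w : Expr} {Γ X X₁ X₂ Y Y₁ A B C}
    (he : Has e (pushVar (pushVar Γ A) B) (pushVar (pushVar X₁ True) True) C)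
    (hp : Parts X Y X₂) (hp' : Parts Y X₁ Y₁) (hv : v.IsValue) (hw : w.IsValue)
    (htv : Has v Γ Y₁ A) (htw : Has w Γ X₂ B) : Has (e.instPair v w) Γ X C := by
  have hσ : e.instPair v w = e.subst (consSubst w (consSubst v .var)) := by
    unfold Expr.instPair
    congr 1
    funext n
    rcases n with _ | _ | n <;> rfl
  exact hσ ▸ he.subst (((SubstTyped.id Γ X₁).cons hp' hv htv).cons hp hw htw)

/-! ### Evaluation contexts -/

theorem Parts.symm {X X₁ X₂ : Name → Prop} (h : Parts X X₁ X₂) : Parts X X₂ X₁ :=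
  fun z => ⟨(h z).2.1, (h z).1, fun k => (h z).2.2 k.symm⟩

theorem Parts.assoc {X A B X₁ X₂ : Name → Prop} (h : Parts X A B) (h' : Parts A X₁ X₂) :
    Parts X (fun z => X₁ z ∨ B z) X₂ :=
  fun z => ⟨fun k => k.elim (fun k => h.left (h'.left k)) h.right, fun k => h.left (h'.right k),
    fun k => k.1.elim (fun k' => (h' z).2.2 ⟨k', k.2⟩) fun k' => (h z).2.2 ⟨h'.right k.2, k'⟩⟩

/-- The bookkeeping of replacing a subterm: `X₁` belongs to the inner context, `B` to its sibling,
and the names `Y` of the new subterm take the place of `X₂`. -/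
theorem Parts.exchange {X A B X₁ X₂ Y Z : Name → Prop} (h : Parts X A B) (h' : Parts A X₁ X₂)
    (hZ : Parts Z (fun z => X₁ z ∨ B z) Y) :
    Parts Z (fun z => X₁ z ∨ Y z) B ∧ Parts (fun z => X₁ z ∨ Y z) X₁ Y :=
  ⟨fun z => ⟨fun k => k.elim (fun k => hZ.left (.inl k)) hZ.right, fun k => hZ.left (.inr k),
    fun k => k.1.elim (fun k' => (h z).2.2 ⟨h'.left k', k.2⟩) fun k' => (hZ z).2.2 ⟨.inr k.2, k'⟩⟩,
  fun z => ⟨.inl, .inr, fun k => (hZ z).2.2 ⟨.inl k.1, k.2⟩⟩⟩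

/-- Decomposition and replacement in one statement: `X₁` is owned by the context and `X₂` by the
term in the hole. The new term may own other names and live in another environment, as long as that
environment agrees on what the context uses. Holes are never under binders, so one environment
serves the context and the hole; evaluation order is irrelevant here. -/
theorem Has.fill_inv {e : Expr} {Γ : Name → Ty} (E : Ctx) : ∀ {X : Name → Prop} {T : Ty},
    Has (E.fill e) Γ X T → ∃ X₁ X₂ U, Parts X X₁ X₂ ∧ Has e Γ X₂ U ∧
      ∀ {Γ' : Name → Ty} {Y Z : Name → Prop} {e' : Expr}, Parts Z X₁ Y → AgreeOn X₁ Γ Γ' →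
        Has e' Γ' Y U → Has (E.fill e') Γ' Z T := by
  induction E with
  | hole =>
    intro X T h
    exact ⟨fun _ => False, X, T, fun z => ⟨False.elim, id, fun h => h.1⟩, h,
      fun hZ _ h => h.weaken fun z hz => hZ.right hz⟩
  | appL E f ih =>
    rintro X T ⟨m, A, B, Y₁, Y₂, hp, he, hf, hT⟩
    obtain ⟨X₁, X₂, U, hX, hU, h⟩ := ih he
    refine ⟨_, X₂, U, hp.assoc hX, hU, fun hZ hΓ he' => ?_⟩
    obtain ⟨h₁, h₂⟩ := hp.exchange hX hZ
    exact ⟨m, A, B, _, Y₂, h₁, h h₂ (hΓ.anti fun _ => .inl) he',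
      hf.mono (fun _ => id) (hΓ.anti fun _ => .inr), hT⟩
  | appR v E ih =>
    rintro X T ⟨m, A, B, Y₁, Y₂, hp, he, hf, hT⟩
    obtain ⟨X₁, X₂, U, hX, hU, h⟩ := ih hf
    refine ⟨_, X₂, U, hp.symm.assoc hX, hU, fun hZ hΓ he' => ?_⟩
    obtain ⟨h₁, h₂⟩ := hp.symm.exchange hX hZ
    exact ⟨m, A, B, Y₁, _, h₁.symm, he.mono (fun _ => id) (hΓ.anti fun _ => .inr),
      h h₂ (hΓ.anti fun _ => .inl) he', hT⟩
  | pairL m E f ih =>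
    rintro X T ⟨A, B, Y₁, Y₂, hp, he, hf, hT⟩
    obtain ⟨X₁, X₂, U, hX, hU, h⟩ := ih he
    refine ⟨_, X₂, U, hp.assoc hX, hU, fun hZ hΓ he' => ?_⟩
    obtain ⟨h₁, h₂⟩ := hp.exchange hX hZ
    exact ⟨A, B, _, Y₂, h₁, h h₂ (hΓ.anti fun _ => .inl) he',
      hf.mono (fun _ => id) (hΓ.anti fun _ => .inr), hT⟩
  | pairR m v E ih =>
    rintro X T ⟨A, B, Y₁, Y₂, hp, he, hf, hT⟩
    obtain ⟨X₁, X₂, U, hX, hU, h⟩ := ih hf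
    refine ⟨_, X₂, U, hp.symm.assoc hX, hU, fun hZ hΓ he' => ?_⟩
    obtain ⟨h₁, h₂⟩ := hp.symm.exchange hX hZ
    exact ⟨A, B, Y₁, _, h₁.symm, he.mono (fun _ => id) (hΓ.anti fun _ => .inr),
      h h₂ (hΓ.anti fun _ => .inl) he', hT⟩
  | letPair E f ih =>
    rintro X T ⟨m, A, B, V, Y₁, Y₂, hp, he, hf, hT⟩
    obtain ⟨X₁, X₂, U, hX, hU, h⟩ := ih he
    refine ⟨_, X₂, U, hp.assoc hX, hU, fun hZ hΓ he' => ?_⟩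
    obtain ⟨h₁, h₂⟩ := hp.exchange hX hZ
    exact ⟨m, A, B, V, _, Y₂, h₁, h h₂ (hΓ.anti fun _ => .inl) he',
      hf.mono (fun _ => id) (((hΓ.anti fun _ => .inr).push A).push B), hT⟩
  | sendL E f ih =>
    rintro X T ⟨A, S, Y₁, Y₂, hp, he, hf, hT⟩
    obtain ⟨X₁, X₂, U, hX, hU, h⟩ := ih he
    refine ⟨_, X₂, U, hp.assoc hX, hU, fun hZ hΓ he' => ?_⟩
    obtain ⟨h₁, h₂⟩ := hp.exchange hX hZ
    exact ⟨A, S, _, Y₂, h₁, h h₂ (hΓ.anti fun _ => .inl) he',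
      hf.mono (fun _ => id) (hΓ.anti fun _ => .inr), hT⟩
  | sendR v E ih =>
    rintro X T ⟨A, S, Y₁, Y₂, hp, he, hf, hT⟩
    obtain ⟨X₁, X₂, U, hX, hU, h⟩ := ih hf
    refine ⟨_, X₂, U, hp.symm.assoc hX, hU, fun hZ hΓ he' => ?_⟩
    obtain ⟨h₁, h₂⟩ := hp.symm.exchange hX hZ
    exact ⟨A, S, Y₁, _, h₁.symm, he.mono (fun _ => id) (hΓ.anti fun _ => .inr),
      h h₂ (hΓ.anti fun _ => .inl) he', hT⟩
  | recv E ih =>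
    rintro X T ⟨A, S, he, hT⟩
    obtain ⟨X₁, X₂, U, hX, hU, h⟩ := ih he
    exact ⟨X₁, X₂, U, hX, hU, fun hZ hΓ he' => ⟨A, S, h hZ hΓ he', hT⟩⟩
  | select l E ih =>
    rintro X T ⟨I, hI, S, hl, he, hT⟩
    obtain ⟨X₁, X₂, U, hX, hU, h⟩ := ih he
    exact ⟨X₁, X₂, U, hX, hU, fun hZ hΓ he' => ⟨I, hI, S, hl, h hZ hΓ he', hT⟩⟩
  | caseOf E I br ih =>
    rintro X T ⟨hI, S, V, Y₁, Y₂, hp, he, hb, hT⟩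
    obtain ⟨X₁, X₂, U, hX, hU, h⟩ := ih he
    refine ⟨_, X₂, U, hp.assoc hX, hU, fun hZ hΓ he' => ?_⟩
    obtain ⟨h₁, h₂⟩ := hp.exchange hX hZ
    exact ⟨hI, S, V, _, Y₂, h₁, h h₂ (hΓ.anti fun _ => .inl) he',
      fun i => (hb i).mono (fun _ => id) ((hΓ.anti fun _ => .inr).push _), hT⟩
  | close E ih =>
    rintro X T ⟨he, hT⟩
    obtain ⟨X₁, X₂, U, hX, hU, h⟩ := ih he
    exact ⟨X₁, X₂, U, hX, hU, fun hZ hΓ he' => ⟨h hZ hΓ he', hT⟩⟩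
  | wait E ih =>
    rintro X T ⟨he, hT⟩
    obtain ⟨X₁, X₂, U, hX, hU, h⟩ := ih he
    exact ⟨X₁, X₂, U, hX, hU, fun hZ hΓ he' => ⟨h hZ hΓ he', hT⟩⟩
  | cast E A p B ih =>
    rintro X T ⟨he, hT⟩
    obtain ⟨X₁, X₂, U, hX, hU, h⟩ := ih he
    exact ⟨X₁, X₂, U, hX, hU, fun hZ hΓ he' => ⟨h hZ hΓ he', hT⟩⟩

theorem Ctx.rename_fill (ρ : Ren) (E : Ctx) (e : Expr) :
    (E.fill e).rename ρ = (E.rename ρ).fill (e.rename ρ) := by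
  induction E <;> simp_all [Ctx.fill, Ctx.rename, Expr.rename]

/-! ### Reduction of expressions preserves types -/

/-- Consistent subtyping is not transitive, so it is never composed: each new cast takes its
relation from a component of an old one, or from a detour through a ground type, and all slack is
absorbed by subsumption. -/
theorem Expr.Step.preserves {e f : Expr} (h : Expr.Step e f) {Γ X T} (ht : Has e Γ X T) :
    Has f Γ X T := by
  cases h with
  | beta hv =>
    obtain ⟨m, A, B, X₁, X₂, hp, ⟨A', B', Y, hY, hm, he, hs⟩, hf, hT⟩ := ht
    cases hs with | arrow h₁ h₂ _ =>
    have hp' : Parts X Y X₂ := fun z => ⟨fun h => hp.left (hY z h), hp.right,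
      fun h => (hp z).2.2 ⟨hY z h.1, h.2⟩⟩
    exact (he.inst hp' hv (hf.sub h₁)).sub (h₂.trans hT)
  | letPair hv hw =>
    obtain ⟨m, A, B, U, X₁, X₂, hp, ⟨A', B', Y₁, Y₂, hp', hv', hw', _, _, hs⟩, he, hT⟩ := ht
    cases hs with | prod h₁ h₂ _ =>
    exact (he.instPair (hp.assoc hp') (fun z => ⟨.inr, .inl, fun k =>
      (hp z).2.2 ⟨hp'.left k.2, k.1⟩⟩) hv hw (hv'.sub h₁) (hw'.sub h₂)).sub hT
  | castDyn => exact ht.1.sub ht.2.2.2.2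
  | castSDyn => exact ht.1.sub ht.2.2.2.2
  | castUnit => exact ht.1.sub ht.2.2.2.2
  | appCast hv hw =>
    obtain ⟨m', A, B, X₁, X₂, hp, ⟨hv', hc, ⟨hA, hB⟩, ⟨hA', hB'⟩, hs⟩, hf, hT⟩ := ht
    cases hs with | arrow h₁ h₂ _ =>
    cases hc with | arrow c₁ c₂ _ =>
    exact ⟨⟨_, _, _, X₁, X₂, hp, hv', ⟨hf.sub h₁, c₁, hA', hA, .refl _⟩, .refl _⟩, c₂, hB, hB',
      h₂.trans hT⟩
  | castPair hv hw =>
    obtain ⟨⟨A, B, X₁, X₂, hp, hv', hw', _, _, hs⟩, hc, ⟨_, hA, hB⟩, ⟨hun, hA', hB'⟩, hT⟩ := ht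
    cases hs with | prod h₁ h₂ _ =>
    cases hc with | prod c₁ c₂ _ =>
    -- The only use of the condition on unrestricted pairs: the components now have the target
    -- types, which consistent subtyping alone would allow to be linear inside an unrestricted pair.
    exact ⟨_, _, X₁, X₂, hp, ⟨hv'.sub h₁, c₁, hA, hA', .refl _⟩,
      ⟨hw'.sub h₂, c₂, hB, hB', .refl _⟩, Mult.Le.of_un fun h => (hun h).1,
      Mult.Le.of_un fun h => (hun h).2, hT⟩
  | sendCast hv hw =>
    obtain ⟨A, R, X₁, X₂, hp, hv', ⟨hw', hc, ⟨hA, hS⟩, ⟨hA', hS'⟩, hs⟩, hT⟩ := ht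
    cases hs with | sess hs => cases hs with | send h₁ h₂ =>
    cases hc with | sess hc => cases hc with | send c₁ c₂ =>
    exact ⟨⟨_, _, X₁, X₂, hp, ⟨hv'.sub h₁, c₁, hA', hA, .refl _⟩, hw', .refl _⟩, .sess c₂, hS, hS',
      .trans (.sess h₂) hT⟩
  | recvCast hw =>
    obtain ⟨A, R, ⟨hw', hc, ⟨hA, hS⟩, ⟨hA', hS'⟩, hs⟩, hT⟩ := ht
    cases hs with | sess hs => cases hs with | recv h₁ h₂ =>
    cases hc with | sess hc => cases hc with | recv c₁ c₂ =>
    exact ⟨⟨_, _, hw', .refl _⟩, .prod c₁ (.sess c₂) .lin_lin, ⟨nofun, hA, hS⟩, ⟨nofun, hA', hS'⟩,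
      .trans (.prod h₁ (.sess h₂) .lin_lin) hT⟩
  | selectCast hk hJI hw =>
    obtain ⟨I', hI', S', hl, ⟨hw', hc, hR, hS, hs⟩, hT⟩ := ht
    cases hs with | sess hs => cases hs with | select _ h =>
    cases hc with | sess hc => cases hc with | select _ c =>
    exact ⟨⟨_, _, _, hJI hk, hw', .refl _⟩, .sess (c _ hk), hR ⟨_, hJI hk⟩, hS ⟨_, hk⟩,
      .trans (.sess (h _ hl)) hT⟩
  | caseCast hIJ hw =>
    obtain ⟨hJ', S', U, X₁, X₂, hp, ⟨hw', hc, hR, hS, hs⟩, hb, hT⟩ := ht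
    cases hs with | sess hs => cases hs with | branch _ h =>
    cases hc with | sess hc => cases hc with | branch _ c =>
    refine ⟨_, _, U, X₁, X₂, hp, hw', fun i => ?_, hT⟩
    -- The function is the old branch and owns what the branches owned; its argument, the cast of
    -- the new bound endpoint, owns only that endpoint.
    refine ⟨.lin, .sess (S' ⟨i.1, hIJ i.2⟩), U, pushVar X₂ False, (· = .var 0), ?_,
      ⟨_, _, pushVar X₂ False, fun _ => id, nofun, ?_, .refl _⟩,
      ⟨⟨.refl _, fun _ => rfl⟩, .sess (c i.1 i.2), hR i, hS ⟨i.1, hIJ i.2⟩,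
        .sess (h i.1 (hIJ i.2))⟩, .refl _⟩
    · refine forall_pushVar.2 ⟨by simp, fun z => ?_⟩
      simp [Name.rename_shiftVar_ne]
    · refine (hb ⟨i.1, hIJ i.2⟩).rename
        (Name.rename_liftVar_injective Name.rename_shiftVar_injective) ?_ ?_
      · exact forall_pushVar.2 ⟨rfl, fun z => by simp⟩
      · exact forall_pushVar.2 ⟨by simp, fun z => by simp⟩
  | closeCast => exact ⟨ht.1.1, ht.2⟩
  | waitCast => exact ⟨ht.1.1, ht.2⟩
  | toDyn _ hG _ _ hc =>
    exact ⟨⟨ht.1, hc.1, ht.2.2.1, hG.wellFormed, .refl _⟩, .dyn_right _, hG.wellFormed, ht.2.2.2⟩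
  | fromDyn _ hG _ _ hc =>
    exact ⟨⟨ht.1, .dyn_left _, ht.2.2.1, hG.wellFormed, .refl _⟩, hc.2, hG.wellFormed, ht.2.2.2⟩
  | toSDyn _ hG _ _ hc =>
    exact ⟨⟨ht.1, .sess hc.1, ht.2.2.1, hG.wellFormed, .refl _⟩, .sess (.dyn_right _),
      hG.wellFormed, ht.2.2.2⟩
  | fromSDyn _ hG _ _ hc =>
    exact ⟨⟨ht.1, .sess (.dyn_left _), ht.2.2.1, hG.wellFormed, .refl _⟩, .sess hc.2,
      hG.wellFormed, ht.2.2.2⟩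

/-! ### Affine typing of processes -/

/-- Affine typing of processes; blame and locked references are always typed. -/
def WT : Proc → (Name → Ty) → (Name → Prop) → Prop
  | .thread e, Γ, X => ∃ T, Has e Γ X T
  | .par P Q, Γ, X => ∃ X₁ X₂, Parts X X₁ X₂ ∧ WT P Γ X₁ ∧ WT Q Γ X₂
  | .nuChan P, Γ, X => ∃ S : STy,
      WT P (pushChan Γ (.sess S) (.sess S.dual)) (pushChan X True True)
  -- The dynamic type is unrestricted, so a reference needs no permission; the linear names of the
  -- stored value are owned by the store.
  | .nuRef P, Γ, X => WT P (pushRef Γ .dyn) (pushRef X False)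
  | .store _ w G _, Γ, X => Has w Γ X G ∧ G.WellFormed
  | .locked _ _, _, _ => True
  | .blameBoth _ _ _, _, _ => True
  | .blameOne _ _, _, _ => True

theorem pushChan_mono {X X' : Name → Prop} (h : ∀ z, X z → X' z) (p q : Prop) :
    ∀ z, pushChan X p q z → pushChan X' p q z :=
  forall_pushChan.2 ⟨id, id, fun z => by simpa using h z⟩

theorem pushRef_mono {X X' : Name → Prop} (h : ∀ z, X z → X' z) (p : Prop) :
    ∀ z, pushRef X p z → pushRef X' p z :=
  forall_pushRef.2 ⟨id, fun z => by simpa using h z⟩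

theorem WT.weaken {P : Proc} : ∀ {Γ X X'}, WT P Γ X → (∀ z, X z → X' z) → WT P Γ X' := by
  induction P with
  | thread e => rintro Γ X X' ⟨T, h⟩ hX; exact ⟨T, h.weaken hX⟩
  | par P Q _ _ => rintro Γ X X' ⟨X₁, X₂, hp, h⟩ hX; exact ⟨X₁, X₂, hp.mono hX, h⟩
  | nuChan P ih => rintro Γ X X' ⟨S, h⟩ hX; exact ⟨S, ih h (pushChan_mono hX _ _)⟩
  | nuRef P ih => intro Γ X X' h hX; exact ih (X := pushRef X False) h (pushRef_mono hX _)
  | store a w G p => rintro Γ X X' ⟨h, hG⟩ hX; exact ⟨h.weaken hX, hG⟩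
  | _ => intros; trivial

theorem WT.rename {P : Proc} : ∀ {ρ : Ren} {Γ Γ' : Name → Ty} {X X' : Name → Prop},
    WT P Γ X → Function.Injective (Name.rename ρ) → (∀ z, Γ z = Γ' (z.rename ρ)) →
    (∀ z, X z → X' (z.rename ρ)) → WT (P.rename ρ) Γ' X' := by
  induction P with
  | thread e => rintro ρ Γ Γ' X X' ⟨T, h⟩ hρ hΓ hX; exact ⟨T, h.rename hρ hΓ hX⟩
  | par P Q ihP ihQ =>
    rintro ρ Γ Γ' X X' ⟨X₁, X₂, hp, hP, hQ⟩ hρ hΓ hX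
    exact ⟨_, _, hp.image hρ hX, ihP hP hρ hΓ fun _ => imageRen_apply,
      ihQ hQ hρ hΓ fun _ => imageRen_apply⟩
  | nuChan P ih =>
    rintro ρ Γ Γ' X X' ⟨S, h⟩ hρ hΓ hX
    exact ⟨S, ih h (Name.rename_liftChan_injective hρ) (pushChan_lift _ _ rfl rfl hΓ)
      (pushChan_lift (r := fun a b => a → b) _ _ id id hX)⟩
  | nuRef P ih =>
    intro ρ Γ Γ' X X' h hρ hΓ hX
    exact ih (Γ := pushRef Γ .dyn) (X := pushRef X False) h (Name.rename_liftRef_injective hρ)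
      (pushRef_lift _ rfl hΓ) (pushRef_lift (r := fun a b => a → b) _ id hX)
  | store a w G p => rintro ρ Γ Γ' X X' ⟨h, hG⟩ hρ hΓ hX; exact ⟨h.rename hρ hΓ hX, hG⟩
  | _ => intros; trivial

theorem WT.of_rename {P : Proc} : ∀ {ρ : Ren} {Γ : Name → Ty} {X : Name → Prop},
    WT (P.rename ρ) Γ X → WT P (Γ ∘ Name.rename ρ) (X ∘ Name.rename ρ) := by
  induction P with
  | thread e => rintro ρ Γ X ⟨T, h⟩; exact ⟨T, h.of_rename⟩
  | par P Q ihP ihQ =>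
    rintro ρ Γ X ⟨X₁, X₂, hp, hP, hQ⟩
    exact ⟨_, _, fun z => hp _, ihP hP, ihQ hQ⟩
  | nuChan P ih =>
    rintro ρ Γ X ⟨S, h⟩
    exact ⟨S, by simpa only [pushChan_comp_lift] using ih h⟩
  | nuRef P ih =>
    intro ρ Γ X h
    simpa only [WT, pushRef_comp_lift] using
      ih (ρ := ρ.liftRef) (Γ := pushRef Γ .dyn) (X := pushRef X False) h
  | store a w G p => rintro ρ Γ X ⟨h, hG⟩; exact ⟨h.of_rename, hG⟩
  | _ => intros; trivial

/-- Strengthening: a weakened process loses nothing when the two endpoints are removed, whatever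
their types and even if `X` contains them. -/
theorem WT.of_rename_shiftChan {P : Proc} {Γ : Name → Ty} {A B : Ty} {X : Name → Prop}
    (h : WT (P.rename .shiftChan) (pushChan Γ A B) X) : WT P Γ (X ∘ Name.rename .shiftChan) := by
  have hΓ : pushChan Γ A B ∘ Name.rename .shiftChan = Γ := by funext z; simp
  exact hΓ ▸ h.of_rename

theorem WT.of_rename_shiftRef {P : Proc} {Γ : Name → Ty} {A : Ty} {X : Name → Prop}
    (h : WT (P.rename .shiftRef) (pushRef Γ A) X) : WT P Γ (X ∘ Name.rename .shiftRef) := by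
  have hΓ : pushRef Γ A ∘ Name.rename .shiftRef = Γ := by funext z; simp
  exact hΓ ▸ h.of_rename

/-! ### Structural congruence preserves typing -/

theorem Name.rename_swapEnds_involutive : Function.Involutive (Name.rename .swapEnds) := by
  rintro (_ | (_ | _ | _) | _) <;> rfl
theorem Name.rename_swapChans_involutive : Function.Involutive (Name.rename .swapChans) := by
  rintro (_ | (_ | _ | _ | _ | _) | _) <;> rfl
theorem Name.rename_swapRefs_involutive : Function.Involutive (Name.rename .swapRefs) := by
  rintro (_ | _ | (_ | _ | _)) <;> rfl

theorem WT.rename_iff {P : Proc} {ρ : Ren} (hρ : Function.Involutive (Name.rename ρ))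
    {Γ Γ' : Name → Ty} {X X' : Name → Prop} (hΓ : ∀ z, Γ z = Γ' (z.rename ρ))
    (hX : ∀ z, X z = X' (z.rename ρ)) : WT P Γ X ↔ WT (P.rename ρ) Γ' X' := by
  refine ⟨fun h => h.rename hρ.injective hΓ fun z => (hX z).mp, fun h => ?_⟩
  rw [funext hΓ, funext hX]
  exact h.of_rename

theorem Parts.of_empty (X : Name → Prop) : Parts X X (fun _ => False) :=
  fun _ => ⟨id, False.elim, fun h => h.2⟩

/-- An equivalence is needed since congruence is symmetric. The affine slack pays off in the laws
that move scopes or drop the unit thread, where permissions may have gone to a process that does not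
use them. -/
theorem Proc.Cong.wt_iff {P Q : Proc} (h : Proc.Cong P Q) : ∀ {Γ X}, WT P Γ X ↔ WT Q Γ X := by
  induction h with
  | refl => rfl
  | symm _ ih => exact ih.symm
  | trans _ _ ih₁ ih₂ => exact ih₁.trans ih₂
  | congPar _ _ ih₁ ih₂ => intro Γ X; simp only [WT, ih₁, ih₂]
  | congNuChan _ ih => intro Γ X; simp only [WT, ih]
  | congNuRef _ ih => intro Γ X; simp only [WT, ih]
  | parComm P Q =>
    exact ⟨fun ⟨X₁, X₂, hp, h₁, h₂⟩ => ⟨X₂, X₁, hp.symm, h₂, h₁⟩,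
      fun ⟨X₁, X₂, hp, h₁, h₂⟩ => ⟨X₂, X₁, hp.symm, h₂, h₁⟩⟩
  | parAssoc P Q R =>
    intro Γ X
    constructor
    · rintro ⟨X₁, X₂, hp, h₁, ⟨X₃, X₄, hp', h₃, h₄⟩⟩
      exact ⟨_, X₄, hp.symm.assoc hp', ⟨X₁, X₃, fun z => ⟨.inr, .inl, fun k =>
        (hp z).2.2 ⟨k.1, hp'.left k.2⟩⟩, h₁, h₃⟩, h₄⟩
    · rintro ⟨X₁, X₂, hp, ⟨X₃, X₄, hp', h₃, h₄⟩, h₂⟩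
      exact ⟨X₃, _, (hp.assoc hp'.symm).symm, h₃, ⟨X₄, X₂, fun z => ⟨.inl, .inr, fun k =>
        (hp z).2.2 ⟨hp'.right k.1, k.2⟩⟩, h₄, h₂⟩⟩
  | parUnit P =>
    intro Γ X
    exact ⟨fun ⟨X₁, X₂, hp, h₁, _⟩ => h₁.weaken fun _ => hp.left,
      fun h => ⟨X, _, .of_empty X, h, .unit, Ty.Sub.unit⟩⟩
  | nuChanEnds P =>
    intro Γ X
    -- Exchanging the ends replaces `S` by its dual, and duality is an involution.
    have key (S : STy) : WT P (pushChan Γ (.sess S) (.sess S.dual)) (pushChan X True True) ↔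
        WT (P.rename .swapEnds) (pushChan Γ (.sess S.dual) (.sess S)) (pushChan X True True) :=
      WT.rename_iff Name.rename_swapEnds_involutive
        (by rintro (_ | (_ | _ | _) | _) <;> rfl) (by rintro (_ | (_ | _ | _) | _) <;> rfl)
    constructor
    · rintro ⟨S, h⟩
      exact ⟨S.dual, by rw [STy.dual_dual]; exact (key S).1 h⟩
    · rintro ⟨S, h⟩
      exact ⟨S.dual, (key S.dual).2 (by rwa [STy.dual_dual])⟩
  | nuChanPar P Q =>
    intro Γ X
    constructor
    · rintro ⟨X₁, X₂, hp, ⟨S, hP⟩, hQ⟩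
      exact ⟨S, _, pushChan X₂ False False, forall_pushChan.2 ⟨by simp, by simp, fun z => by
        simpa using hp z⟩, hP, hQ.rename Name.rename_shiftChan_injective (by simp) (by simp)⟩
    · rintro ⟨S, X₁, X₂, hp, hP, hQ⟩
      -- The split under the binder may have given an endpoint to `Q`, which cannot mention it. Both
      -- endpoints are handed to `P`, and `Q` is strengthened.
      refine ⟨_, _, fun z => ?_, ⟨S, hP.weaken (X' := pushChan (X₁ ∘ Name.rename .shiftChan) True True)
        (forall_pushChan.2 (by simp))⟩, hQ.of_rename_shiftChan⟩
      simpa using hp (z.rename .shiftChan)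
  | nuChanChan P =>
    intro Γ X
    have key (S R : STy) : WT P (pushChan (pushChan Γ (.sess S) (.sess S.dual)) (.sess R)
          (.sess R.dual)) (pushChan (pushChan X True True) True True) ↔
        WT (P.rename .swapChans) (pushChan (pushChan Γ (.sess R) (.sess R.dual)) (.sess S)
          (.sess S.dual)) (pushChan (pushChan X True True) True True) :=
      WT.rename_iff Name.rename_swapChans_involutive
        (by rintro (_ | (_ | _ | _ | _ | _) | _) <;> rfl)
        (by rintro (_ | (_ | _ | _ | _ | _) | _) <;> rfl)
    exact ⟨fun ⟨S, R, h⟩ => ⟨R, S, (key S R).1 h⟩, fun ⟨S, R, h⟩ => ⟨R, S, (key R S).2 h⟩⟩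
  | nuRefPar P Q =>
    intro Γ X
    constructor
    · rintro ⟨X₁, X₂, hp, hP, hQ⟩
      exact ⟨pushRef X₁ False, pushRef X₂ False, forall_pushRef.2 ⟨by simp, fun z => by
        simpa using hp z⟩, hP, hQ.rename Name.rename_shiftRef_injective (by simp) (by simp)⟩
    · rintro ⟨X₁, X₂, hp, hP, hQ⟩
      refine ⟨_, _, fun z => ?_, hP.weaken (X' := pushRef (X₁ ∘ Name.rename .shiftRef) False)
        (forall_pushRef.2 ⟨fun h => (hp _).1 h, by simp⟩), hQ.of_rename_shiftRef⟩
      simpa using hp (z.rename .shiftRef)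
  | nuRefRef P =>
    intro Γ X
    exact WT.rename_iff (Γ := pushRef (pushRef Γ .dyn) .dyn)
      (X := pushRef (pushRef X False) False) (Γ' := pushRef (pushRef Γ .dyn) .dyn)
      (X' := pushRef (pushRef X False) False) Name.rename_swapRefs_involutive
      (by rintro (_ | _ | (_ | _ | _)) <;> rfl) (by rintro (_ | _ | (_ | _ | _)) <;> rfl)
  | nuChanRef P =>
    intro Γ X
    have key {α : Type} (f : Name → α) (a b c : α) :
        pushRef (pushChan f a b) c = pushChan (pushRef f c) a b := by
      funext z; rcases z with _ | (_ | _ | _) | (_ | _) <;> rfl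
    simp only [WT, key]

/-! ### Reduction of processes preserves typing -/

/-- Session types are linear, so a term that owns neither endpoint is insensitive to which session
types they have. -/
theorem AgreeOn.pushChan {X : Name → Prop} (Γ : Name → Ty) (S S' R R' : STy)
    (h₀ : ¬ X (.chan 0)) (h₁ : ¬ X (.chan 1)) :
    AgreeOn X (pushChan Γ (.sess S) (.sess S')) (pushChan Γ (.sess R) (.sess R')) :=
  forall_pushChan.2 ⟨by simp [h₀, Ty.mult], by simp [h₁, Ty.mult], by simp⟩

theorem Parts.add {X : Name → Prop} {c : Name} (hc : ¬ X c) :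
    Parts (fun z => X z ∨ z = c) X (· = c) :=
  fun _ => ⟨.inl, .inr, fun h => hc (h.2 ▸ h.1)⟩

theorem Parts.addRight {X Y Z : Name → Prop} {c : Name} (h : Parts X Y Z) (hc : ¬ Y c) :
    Parts (fun z => X z ∨ z = c) Y (fun z => Z z ∨ z = c) :=
  fun z => ⟨fun k => .inl (h.left k), .imp_left h.right, fun k =>
    k.2.elim (fun k' => (h z).2.2 ⟨k.1, k'⟩) fun k' => hc (k' ▸ k.1)⟩

/-- After a synchronisation each thread gets its own endpoint back. The other two side conditions
needed to type the threads are not needed for disjointness. -/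
theorem Parts.addEnds {X Y Z : Name → Prop} (h : Parts (pushChan X True True) Y Z)
    (h₁ : ¬ Y (.chan 1)) (k₀ : ¬ Z (.chan 0)) :
    Parts (pushChan X True True) (fun z => Y z ∨ z = .chan 0) (fun z => Z z ∨ z = .chan 1) := by
  refine forall_pushChan.2 ⟨by simp [k₀], by simp [h₁], fun z => ?_⟩
  simpa [Name.rename_shiftChan_ne_zero, Name.rename_shiftChan_ne_one] using h (z.rename .shiftChan)

/-- In each synchronisation the redexes own the two endpoints, so all that surrounds them owns
neither and survives the change of the channel's type. -/
theorem Proc.Step.preserves {P Q : Proc} (h : Proc.Step P Q) : ∀ {Γ X}, WT P Γ X → WT Q Γ X := by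
  induction h with
  | fork hE =>
    rintro Γ X ⟨T, ht⟩
    obtain ⟨X₁, X₂, U, hp, ⟨he, hs⟩, h⟩ := ht.fill_inv
    exact ⟨X₁, X₂, hp, ⟨T, h (.of_empty X₁) (.refl _ _) hs⟩, ⟨_, he⟩⟩
  | @new E hE =>
    rintro Γ X ⟨T, ht⟩
    -- The types `.close` are placeholders: the weakened thread owns neither endpoint, so they can
    -- be exchanged for `S` and `S.dual` once the `S` chosen by `new` is known.
    have ht' := ht.rename (Γ' := pushChan Γ (.sess .close) (.sess .close))
      (X' := pushChan X False False) Name.rename_shiftChan_injective (by simp) (by simp)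
    rw [Ctx.rename_fill] at ht'
    obtain ⟨X₁, X₂, U, hp, ⟨S, hs⟩, h⟩ := ht'.fill_inv
    have h₀ : ¬ X₁ (.chan 0) := fun h => hp.left h
    have h₁ : ¬ X₁ (.chan 1) := fun h => hp.left h
    refine ⟨S, T, h (Y := fun z => z = .chan 0 ∨ z = .chan 1) ?_
      (.pushChan _ _ _ _ _ h₀ h₁) ⟨_, _, (· = .chan 0), (· = .chan 1),
      fun z => ⟨.inl, .inr, by rintro ⟨rfl, h⟩; cases h⟩, ⟨.refl _, fun _ => rfl⟩,
      ⟨.refl _, fun _ => rfl⟩, .lin_lin, .lin_lin, hs⟩⟩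
    refine forall_pushChan.2 ⟨by simp [h₀], by simp [h₁], fun z => ?_⟩
    have := hp.left (z := z.rename .shiftChan)
    simp only [pushChan_shift] at this
    simpa [Name.rename_shiftChan_ne_zero, Name.rename_shiftChan_ne_one] using this
  | comm hE hF hv =>
    rintro Γ X ⟨S, X₁, X₂, hp, ⟨T₁, ht₁⟩, ⟨T₂, ht₂⟩⟩
    obtain ⟨A₁, A₂, U, hA, ⟨A, R, B₁, B₂, hB, hv', ⟨hs₀, hx₀⟩, hT⟩, h₁⟩ := ht₁.fill_inv
    obtain ⟨C₁, C₂, V, hC, ⟨A', R', ⟨hs₁, hx₁⟩, hT'⟩, h₂⟩ := ht₂.fill_inv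
    replace hx₀ := hx₀ rfl
    replace hx₁ := hx₁ rfl
    simp only [pushChan_zero, pushChan_one] at hs₀ hs₁
    cases hs₀ with | sess hs₀ => cases hs₀ with | @send T₀ _ R₀ _ k₁ k₂ =>
    rw [STy.dual] at hs₁
    cases hs₁ with | sess hs₁ => cases hs₁ with | recv k₃ k₄ =>
    have e₀ := hA.right (hB.right hx₀)
    have e₁ := hC.right hx₁
    have a₀ : ¬ A₁ (.chan 0) := fun k => (hA _).2.2 ⟨k, hB.right hx₀⟩
    have a₁ : ¬ A₁ (.chan 1) := fun k => (hp _).2.2 ⟨hA.left k, e₁⟩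
    have b₀ : ¬ B₁ (.chan 0) := fun k => (hB _).2.2 ⟨k, hx₀⟩
    have b₁ : ¬ B₁ (.chan 1) := fun k => (hp _).2.2 ⟨hA.right (hB.left k), e₁⟩
    have c₀ : ¬ C₁ (.chan 0) := fun k => (hp _).2.2 ⟨e₀, hC.left k⟩
    have c₁ : ¬ C₁ (.chan 1) := fun k => (hC _).2.2 ⟨k, hx₁⟩
    have hBC : Parts (fun z => C₁ z ∨ B₁ z) C₁ B₁ := fun z => ⟨.inl, .inr, fun k =>
      (hp z).2.2 ⟨hA.right (hB.left k.2), hC.left k.1⟩⟩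
    have hY : Parts (pushChan X True True) A₁ (fun z => C₁ z ∨ B₁ z) := fun z =>
      ⟨fun k => hp.left (hA.left k), fun k => k.elim (fun k => hp.right (hC.left k)) fun k =>
        hp.left (hA.right (hB.left k)), fun k => k.2.elim (fun k' => (hp z).2.2
          ⟨hA.left k.1, hC.left k'⟩) fun k' => (hA z).2.2 ⟨k.1, hB.left k'⟩⟩
    -- The new channel type is the continuation of the declared type; the continuations seen by the
    -- two threads are supertypes of it and of its dual. The names `B₁` of the message move to the
    -- receiver, whose payload type is reached through the declared one by `k₁` and `k₃`.
    refine ⟨R₀, _, _, hY.addEnds a₁ (by simp [b₀, c₀]),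
      ⟨T₁, h₁ (Parts.add a₀) (.pushChan _ _ _ _ _ a₀ a₁) ⟨.trans (.sess k₂) hT, fun _ => rfl⟩⟩,
      ⟨T₂, h₂ (hBC.addRight c₁) (.pushChan _ _ _ _ _ c₀ c₁)
        ⟨_, _, B₁, (· = .chan 1), Parts.add b₁,
          (hv'.sub (k₁.trans k₃)).mono (fun _ => id) (.pushChan _ _ _ _ _ b₀ b₁),
          ⟨.sess k₄, fun _ => rfl⟩, .of_un nofun, .lin_lin, hT'⟩⟩⟩
  | @choice E F I br j hj hE hF =>
    rintro Γ X ⟨S, X₁, X₂, hp, ⟨T₁, ht₁⟩, ⟨T₂, ht₂⟩⟩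
    obtain ⟨A₁, A₂, U, hA, ⟨I', hI', S', hl, ⟨hs₀, hx₀⟩, hT⟩, h₁⟩ := ht₁.fill_inv
    obtain ⟨C₁, C₂, V, hC, ⟨hI, R', W, D₁, D₂, hD, ⟨hs₁, hx₁⟩, hb, hT'⟩, h₂⟩ := ht₂.fill_inv
    replace hx₀ := hx₀ rfl
    replace hx₁ := hx₁ rfl
    simp only [pushChan_zero, pushChan_one] at hs₀ hs₁
    cases hs₀ with | sess hs₀ => cases hs₀ with | @select I₀ _ _ _ S₀ _ hI₀ k₁ =>
    rw [STy.dual] at hs₁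
    cases hs₁ with | sess hs₁ => cases hs₁ with | branch _ k₂ =>
    have e₀ := hA.right hx₀
    have e₁ := hC.right (hD.left hx₁)
    have a₀ : ¬ A₁ (.chan 0) := fun k => (hA _).2.2 ⟨k, hx₀⟩
    have a₁ : ¬ A₁ (.chan 1) := fun k => (hp _).2.2 ⟨hA.left k, e₁⟩
    have d₀ : ¬ D₂ (.chan 0) := fun k => (hp _).2.2 ⟨e₀, hC.right (hD.right k)⟩
    have d₁ : ¬ D₂ (.chan 1) := fun k => (hD _).2.2 ⟨hx₁, k⟩
    have c₀ : ¬ C₁ (.chan 0) := fun k => (hp _).2.2 ⟨e₀, hC.left k⟩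
    have c₁ : ¬ C₁ (.chan 1) := fun k => (hC _).2.2 ⟨k, hD.left hx₁⟩
    have hCD : Parts (fun z => C₁ z ∨ D₂ z) C₁ D₂ := fun z => ⟨.inl, .inr, fun k =>
      (hC z).2.2 ⟨k.1, hD.right k.2⟩⟩
    have hY : Parts (pushChan X True True) A₁ (fun z => C₁ z ∨ D₂ z) := fun z =>
      ⟨fun k => hp.left (hA.left k), fun k => k.elim (fun k => hp.right (hC.left k)) fun k =>
        hp.right (hC.right (hD.right k)), fun k => (hp z).2.2 ⟨hA.left k.1, k.2.elim hC.left
          fun k' => hC.right (hD.right k')⟩⟩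
    -- The chosen branch owns neither endpoint before the instantiation, so it can be retyped over
    -- the continuation at `j` before the endpoint is substituted.
    have hb' := (hb ⟨j, hj⟩).mono (fun _ => id)
      ((AgreeOn.pushChan Γ _ _ (S₀ ⟨j, hI₀ hl⟩) (S₀ ⟨j, hI₀ hl⟩).dual d₀ d₁).push _)
    exact ⟨S₀ ⟨j, hI₀ hl⟩, _, _, hY.addEnds a₁ (by simp [c₀, d₀]),
      ⟨T₁, h₁ (Parts.add a₀) (.pushChan _ _ _ _ _ a₀ a₁)
        ⟨.trans (.sess (k₁ j hl)) hT, fun _ => rfl⟩⟩,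
      ⟨T₂, h₂ (hCD.addRight c₁) (.pushChan _ _ _ _ _ c₀ c₁)
        ((hb'.inst (Parts.add d₁) (.chan 1)
          ⟨.sess (k₂ j (hI₀ hl)), fun _ => rfl⟩).sub hT')⟩⟩
  | close hE hF =>
    rintro Γ X ⟨S, X₁, X₂, hp, ⟨T₁, ht₁⟩, ⟨T₂, ht₂⟩⟩
    obtain ⟨A₁, A₂, U, hA, ⟨_, hT⟩, h₁⟩ := ht₁.fill_inv
    obtain ⟨C₁, C₂, V, hC, ⟨_, hT'⟩, h₂⟩ := ht₂.fill_inv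
    have r₁ := h₁ (e' := .unit) hA (.refl _ _) hT
    have r₂ := h₂ (e' := .unit) hC (.refl _ _) hT'
    -- Since `()` is its own renaming, each thread is a weakened one and both endpoints can be
    -- removed.
    rw [← Expr.rename, ← Ctx.rename_fill] at r₁ r₂
    refine ⟨_, _, fun z => ?_, WT.of_rename_shiftChan ⟨_, r₁⟩, WT.of_rename_shiftChan ⟨_, r₂⟩⟩
    simpa using hp (z.rename .shiftChan)
  | alloc hE hv hG _ _ =>
    rintro Γ X ⟨T, ht⟩
    have ht' := ht.rename (Γ' := pushRef Γ .dyn) (X' := pushRef X False)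
      Name.rename_shiftRef_injective (by simp) (by simp)
    rw [Ctx.rename_fill] at ht'
    obtain ⟨X₁, X₂, U, hp, ⟨hv', _, _, _, hs⟩, h⟩ := ht'.fill_inv
    -- The names `X₂` of the value go to the store, and the reference left in the thread owns
    -- nothing.
    exact ⟨X₁, X₂, hp, ⟨T, h (.of_empty X₁) (.refl _ _) ⟨hs, nofun⟩⟩, hv', hG.wellFormed⟩
  | access hE hv hG hU =>
    rintro Γ X ⟨X₁, X₂, hp, ⟨T, ht⟩, ⟨hv', hwf⟩⟩
    obtain ⟨A₁, A₂, V, hA, ⟨_, hc, hd, hU', hs⟩, h⟩ := ht.fill_inv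
    have hX : Parts X X₂ A₁ := fun z => ⟨hp.right, fun k => hp.left (hA.left k),
      fun k => (hp z).2.2 ⟨hA.left k.2, k.1⟩⟩
    -- The names of the stored value pass to the thread. The locked reference needs none, so the
    -- value is not duplicated.
    exact ⟨X, _, .of_empty X, ⟨T, h hX.symm (.refl _ _)
      ⟨⟨hv', .dyn_right _, hwf, hd, .refl _⟩, hc, hd, hU', hs⟩⟩, trivial⟩
  | accessLocked => rintro Γ X ⟨X₁, X₂, hp, _, _⟩; exact ⟨X₁, X₂, hp, trivial, trivial⟩
  | freeLocked => intro Γ X _; exact ⟨.unit, Ty.Sub.unit⟩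
  | freeStore => intros; trivial
  | collapse hE hv hG hU hGU =>
    rintro Γ X ⟨T, ht⟩
    obtain ⟨X₁, X₂, U, hp, ⟨⟨hv', _⟩, _, _, _, hs⟩, h⟩ := ht.fill_inv
    exact ⟨T, h hp (.refl _ _) (hv'.sub (hGU.trans hs))⟩
  | collide => intros; trivial
  | collapseS hE hv hG hR hGR =>
    rintro Γ X ⟨T, ht⟩
    obtain ⟨X₁, X₂, U, hp, ⟨⟨hv', _⟩, _, _, _, hs⟩, h⟩ := ht.fill_inv
    exact ⟨T, h hp (.refl _ _) (hv'.sub (.trans (.sess hGR) hs))⟩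
  | collideS => intros; trivial
  | @collapseEnds E F G R p q hE hF hG hR hGR =>
    rintro Γ X ⟨S, X₁, X₂, hp, ⟨T₁, ht₁⟩, ⟨T₂, ht₂⟩⟩
    obtain ⟨A₁, A₂, U, hA, ⟨⟨hs₀, hx₀⟩, _, _, _, hT⟩, h₁⟩ := ht₁.fill_inv
    obtain ⟨C₁, C₂, V, hC, ⟨⟨hs₁, hx₁⟩, _, _, _, hT'⟩, h₂⟩ := ht₂.fill_inv
    replace hx₀ := hx₀ rfl
    replace hx₁ := hx₁ rfl
    have a₀ : ¬ A₁ (.chan 0) := fun k => (hA _).2.2 ⟨k, hx₀⟩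
    have a₁ : ¬ A₁ (.chan 1) := fun k => (hp _).2.2 ⟨hA.left k, hC.right hx₁⟩
    have c₀ : ¬ C₁ (.chan 0) := fun k => (hp _).2.2 ⟨hA.right hx₀, hC.left k⟩
    have c₁ : ¬ C₁ (.chan 1) := fun k => (hC _).2.2 ⟨k, hx₁⟩
    have hY : Parts (pushChan X True True) A₁ C₁ := fun z => ⟨fun k => hp.left (hA.left k),
      fun k => hp.right (hC.left k), fun k => (hp z).2.2 ⟨hA.left k.1, hC.left k.2⟩⟩
    -- The dynamic channel is retyped at `G`; the other end then has type `G.dual`, a subtype of `R`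
    -- by the side condition of the rule.
    exact ⟨G, _, _, hY.addEnds a₁ c₀,
      ⟨T₁, h₁ (Parts.add a₀) (.pushChan _ _ _ _ _ a₀ a₁) ⟨hT, fun _ => rfl⟩⟩,
      ⟨T₂, h₂ (Parts.add c₁) (.pushChan _ _ _ _ _ c₀ c₁)
        ⟨.trans (.sess hGR) hT', fun _ => rfl⟩⟩⟩
  -- Blame is typed in any environment, so any session type will do for the channel.
  | collideEnds => intro Γ X _; exact ⟨.close, trivial⟩
  | par _ ih => rintro Γ X ⟨X₁, X₂, hp, h₁, h₂⟩; exact ⟨X₁, X₂, hp, ih h₁, h₂⟩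
  | nuChan _ ih => rintro Γ X ⟨S, h⟩; exact ⟨S, ih h⟩
  | nuRef _ ih => intro Γ X h; exact ih (Γ := pushRef Γ .dyn) (X := pushRef X False) h
  | cong h₁ _ h₂ ih => intro Γ X h; exact h₂.wt_iff.1 (ih (h₁.wt_iff.1 h))
  | expr hE he =>
    rintro Γ X ⟨T, ht⟩
    obtain ⟨X₁, X₂, U, hp, ht', h⟩ := ht.fill_inv
    exact ⟨T, h hp (.refl _ _) (he.preserves ht')⟩

/-! ### Linear typing implies affine typing -/

/-- Splitting sends each linear name to exactly one side; the names it shares are unrestricted and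
not in `Env.flv`. -/
theorem Env.Split.parts {Γ Γ₁ Γ₂ : Env} (h : Γ.Split Γ₁ Γ₂) :
    Parts (· ∈ Γ.flv) (· ∈ Γ₁.flv) (· ∈ Γ₂.flv) := by
  intro z
  have := h z
  simp only [Env.flv, Set.mem_ofPred_eq]
  generalize Γ z = a at *
  generalize Γ₁ z = b at *
  generalize Γ₂ z = c at *
  cases this <;> simp_all

/-- The total environment `Δ` has all the types of `Γ`. -/
def Env.Extends (Γ : Env) (Δ : Name → Ty) : Prop := ∀ z T, Γ z = some T → Δ z = T

theorem SplitAt.of_left {a b c : Option Ty} (h : SplitAt a b c) {T : Ty} (hb : b = some T) :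
    a = some T := by
  cases h <;> first | exact hb | cases hb

theorem SplitAt.of_right {a b c : Option Ty} (h : SplitAt a b c) {T : Ty} (hc : c = some T) :
    a = some T := by
  cases h <;> first | exact hc | cases hc

theorem Env.Extends.left {Γ Γ₁ Γ₂ : Env} {Δ : Name → Ty} (h : Γ.Extends Δ)
    (hs : Γ.Split Γ₁ Γ₂) : Γ₁.Extends Δ := fun z T hz => h z T ((hs z).of_left hz)

theorem Env.Extends.right {Γ Γ₁ Γ₂ : Env} {Δ : Name → Ty} (h : Γ.Extends Δ)
    (hs : Γ.Split Γ₁ Γ₂) : Γ₂.Extends Δ := fun z T hz => h z T ((hs z).of_right hz)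

theorem Env.consVar_shift (Γ : Env) (A : Ty) (z : Name) :
    Γ.consVar A (z.rename .shiftVar) = Γ z := by cases z <;> rfl

theorem Env.consChan_shift (Γ : Env) (A B : Ty) (z : Name) :
    Γ.consChan A B (z.rename .shiftChan) = Γ z := by cases z <;> rfl

theorem Env.consRef_shift (Γ : Env) (A : Ty) (z : Name) :
    Γ.consRef A (z.rename .shiftRef) = Γ z := by cases z <;> rfl

theorem Env.Extends.consVar {Γ : Env} {Δ : Name → Ty} (h : Γ.Extends Δ) (A : Ty) :
    (Γ.consVar A).Extends (pushVar Δ A) :=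
  forall_pushVar.2 ⟨fun _ => Option.some.inj, fun z => by
    simpa [Env.consVar_shift] using h z⟩

theorem Env.Extends.consChan {Γ : Env} {Δ : Name → Ty} (h : Γ.Extends Δ) (A B : Ty) :
    (Γ.consChan A B).Extends (pushChan Δ A B) :=
  forall_pushChan.2 ⟨fun _ => Option.some.inj, fun _ => Option.some.inj, fun z => by
    simpa [Env.consChan_shift] using h z⟩

theorem Env.Extends.consRef {Γ : Env} {Δ : Name → Ty} (h : Γ.Extends Δ) (A : Ty) :
    (Γ.consRef A).Extends (pushRef Δ A) :=
  forall_pushRef.2 ⟨fun _ => Option.some.inj, fun z => by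
    simpa [Env.consRef_shift] using h z⟩

theorem Env.flv_consVar {Γ : Env} {A : Ty} :
    ∀ z ∈ (Γ.consVar A).flv, pushVar (· ∈ Γ.flv) True z :=
  forall_pushVar.2 ⟨fun _ => trivial, fun z => by simp [Env.flv, Env.consVar_shift]⟩

theorem Env.flv_consChan {Γ : Env} {A B : Ty} :
    ∀ z ∈ (Γ.consChan A B).flv, pushChan (· ∈ Γ.flv) True True z :=
  forall_pushChan.2 ⟨fun _ => trivial, fun _ => trivial, fun z => by
    simp [Env.flv, Env.consChan_shift]⟩

theorem Env.flv_consRef {Γ : Env} :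
    ∀ z ∈ (Γ.consRef .dyn).flv, pushRef (· ∈ Γ.flv) False z := by
  refine forall_pushRef.2 ⟨?_, fun z => by simp [Env.flv, Env.consRef_shift]⟩
  rintro ⟨T, hT, hl⟩
  cases hT
  cases hl

/-- The total environment `Δ` survives splitting unchanged; what linear splitting removes from `Γ`
is recorded in the set of usable names instead. The hypothesis on casts feeds the cast clause. -/
theorem HasType.has {Γ : Env} {e : Expr} {T : Ty} (h : HasType Γ e T) :
    ∀ {Δ : Name → Ty}, e.CastsWellFormed → Γ.Extends Δ → Has e Δ (· ∈ Γ.flv) T := by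
  induction h with
  | @name Γ z T hz _ =>
    intro Δ _ hΔ
    have hT : Δ z = T := hΔ z T hz
    exact ⟨hT ▸ .refl _, fun hl => ⟨T, hz, hT ▸ hl⟩⟩
  | unit => intro _ _ _; exact Ty.Sub.unit
  | lam _ hm ih =>
    rintro Δ hc hΔ
    refine ⟨_, _, _, fun _ => id, ?_, (ih hc (hΔ.consVar _)).weaken Env.flv_consVar, .refl _⟩
    rintro rfl z ⟨T, hz, hl⟩
    have := hm z T hz
    rw [hl] at this
    cases this
  | app hs _ _ ihe ihf =>
    rintro Δ ⟨hc, hc'⟩ hΔ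
    exact ⟨_, _, _, _, _, hs.parts, ihe hc (hΔ.left hs), ihf hc' (hΔ.right hs), .refl _⟩
  | pair hs _ _ hA hB ihe ihf =>
    rintro Δ ⟨hc, hc'⟩ hΔ
    exact ⟨_, _, _, _, hs.parts, ihe hc (hΔ.left hs), ihf hc' (hΔ.right hs), hA, hB, .refl _⟩
  | letPair hs _ _ ihe ihf =>
    rintro Δ ⟨hc, hc'⟩ hΔ
    exact ⟨_, _, _, _, _, _, hs.parts, ihe hc (hΔ.left hs),
      (ihf hc' (((hΔ.right hs).consVar _).consVar _)).weaken fun z hz =>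
        pushVar_mono Env.flv_consVar _ z (Env.flv_consVar z hz), .refl _⟩
  | fork _ ih => intro Δ hc hΔ; exact ⟨ih hc hΔ, .refl _⟩
  | new S _ => intro _ _ _; exact ⟨S, .refl _⟩
  | send hs _ _ ihe ihf =>
    rintro Δ ⟨hc, hc'⟩ hΔ
    exact ⟨_, _, _, _, hs.parts, ihe hc (hΔ.left hs), ihf hc' (hΔ.right hs), .refl _⟩
  | recv _ ih => intro Δ hc hΔ; exact ⟨_, _, ih hc hΔ, .refl _⟩
  | select j _ ih => intro Δ hc hΔ; exact ⟨_, _, _, j.2, ih hc hΔ, .refl _⟩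
  | caseOf hs _ _ ihe ihb =>
    rintro Δ ⟨hc, hc'⟩ hΔ
    exact ⟨_, _, _, _, _, hs.parts, ihe hc (hΔ.left hs), fun i =>
      (ihb i (hc' i) ((hΔ.right hs).consVar _)).weaken Env.flv_consVar, .refl _⟩
  | close _ ih => intro Δ hc hΔ; exact ⟨ih hc hΔ, .refl _⟩
  | wait _ ih => intro Δ hc hΔ; exact ⟨ih hc hΔ, .refl _⟩
  | sub _ hs ih => intro Δ hc hΔ; exact (ih hc hΔ).sub hs
  | cast p _ hcs ih => rintro Δ ⟨hc, hT, hU⟩ hΔ; exact ⟨ih hc hΔ, hcs, hT, hU, .refl _⟩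

theorem Proc.WellTyped.wt {Γ : Env} {P : Proc} (h : Proc.WellTyped Γ P) :
    ∀ {Δ : Name → Ty}, P.CastsWellFormed → Γ.Extends Δ → WT P Δ (· ∈ Γ.flv) := by
  induction h with
  | thread h _ => intro Δ hc hΔ; exact ⟨_, h.has hc hΔ⟩
  | par hs _ _ ihP ihQ =>
    rintro Δ ⟨hc, hc'⟩ hΔ
    exact ⟨_, _, hs.parts, ihP hc (hΔ.left hs), ihQ hc' (hΔ.right hs)⟩
  | nuChan S _ ih =>
    intro Δ hc hΔ
    exact ⟨S, (ih hc (hΔ.consChan _ _)).weaken Env.flv_consChan⟩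
  | nuRef _ ih =>
    intro Δ hc hΔ
    exact (ih hc (hΔ.consRef _)).weaken Env.flv_consRef
  | store p hs _ hw _ _ _ =>
    rintro Δ ⟨hc, hG⟩ hΔ
    exact ⟨(hw.has hc (hΔ.right hs)).weaken fun _ => hs.parts.right, hG⟩
  | _ => intros; trivial

/-! ### Typed processes have no immediate errors -/

/-- No name has a function type or a pair type. -/
def NoArrowOrProd (Γ : Name → Ty) : Prop :=
  ∀ z, (∀ m A B, Γ z ≠ .arrow m A B) ∧ (∀ m A B, Γ z ≠ .prod m A B)

theorem NoArrowOrProd.not_sub_arrow {Γ : Name → Ty} (h : NoArrowOrProd Γ) {z m A B} :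
    ¬ Ty.Sub (Γ z) (.arrow m A B) := by
  intro hs
  generalize hT : Γ z = T at hs
  cases hs
  exact (h z).1 _ _ _ hT

theorem NoArrowOrProd.not_sub_prod {Γ : Name → Ty} (h : NoArrowOrProd Γ) {z m A B} :
    ¬ Ty.Sub (Γ z) (.prod m A B) := by
  intro hs
  generalize hT : Γ z = T at hs
  cases hs
  exact (h z).2 _ _ _ hT

/-- Canonical forms. Endpoints and references are values too, hence the hypothesis on `Γ`; a cast
value of function type is a cast between function types, and induction unwraps it. -/
theorem Has.isAbstraction {v : Expr} (hv : v.IsValue) {Γ : Name → Ty} (hΓ : NoArrowOrProd Γ) :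
    ∀ {X m A B}, Has v Γ X (.arrow m A B) → v.IsAbstraction := by
  induction hv with
  | unit => rintro X m A B ⟨⟩
  | lam m e => intros; exact .lam m e
  | pair => rintro X m A B ⟨_, _, _, _, _, _, _, _, _, ⟨⟩⟩
  | chan c => rintro X m A B ⟨h, _⟩; exact (hΓ.not_sub_arrow h).elim
  | ref a => rintro X m A B ⟨h, _⟩; exact (hΓ.not_sub_arrow h).elim
  | castDyn => rintro X m A B ⟨_, _, _, _, ⟨⟩⟩
  | castSDyn => rintro X m A B ⟨_, _, _, _, ⟨⟩⟩
  | castArrow m n T U T' U' p _ ih => rintro X _ A B ⟨h, _⟩; exact .cast m n T U T' U' p (ih h)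
  | castSess => rintro X m A B ⟨_, _, _, _, ⟨⟩⟩

/-- No induction is needed: a cast to a pair type is never a value. -/
theorem Has.isPair {v : Expr} (hv : v.IsValue) {Γ : Name → Ty} (hΓ : NoArrowOrProd Γ) {X m A B}
    (h : Has v Γ X (.prod m A B)) : v.IsPair := by
  cases hv with
  | unit => cases h
  | lam => obtain ⟨_, _, _, _, _, _, ⟨⟩⟩ := h
  | pair => exact ⟨_, _, _, rfl⟩
  | chan c => exact (hΓ.not_sub_prod h.1).elim
  | ref a => exact (hΓ.not_sub_prod h.1).elim
  | castDyn => obtain ⟨_, _, _, _, ⟨⟩⟩ := h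
  | castSDyn => obtain ⟨_, _, _, _, ⟨⟩⟩ := h
  | castArrow => obtain ⟨_, _, _, _, ⟨⟩⟩ := h
  | castSess => obtain ⟨_, _, _, _, ⟨⟩⟩ := h

theorem Has.name_sess {z : Name} {Γ X S} (h : Has (.name z) Γ X (.sess S)) :
    X z ∧ ∃ R, Γ z = .sess R ∧ STy.Sub R S := by
  obtain ⟨hs, hX⟩ := h
  generalize Γ z = T at *
  cases hs with | sess hs => exact ⟨hX rfl, _, rfl, hs⟩

/-- The session types at which an expression may use its subject. -/
inductive SubjAt : Expr → ℕ → STy → Prop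
  | send {g c T S} : SubjAt (.send g (.chan c)) c (.send T S)
  | recv {c T S} : SubjAt (.recv (.chan c)) c (.recv T S)
  | select {l c I hI S} : l ∈ I → SubjAt (.select l (.chan c)) c (.select I hI S)
  | caseOf {c I br hI S} : SubjAt (.caseOf (.chan c) I br) c (.branch I hI S)
  | close {c} : SubjAt (.close (.chan c)) c .close
  | wait {c} : SubjAt (.wait (.chan c)) c .wait

theorem Has.subjAt {e : Expr} {c : ℕ} (h : e.Subj c) {Γ X T} (ht : Has e Γ X T) :
    X (.chan c) ∧ ∃ R S, Γ (.chan c) = .sess R ∧ STy.Sub R S ∧ SubjAt e c S := by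
  cases h with
  | send =>
    obtain ⟨A, S, X₁, X₂, hp, _, h, _⟩ := ht
    obtain ⟨hX, R, hR, hs⟩ := h.name_sess
    exact ⟨hp.right hX, R, _, hR, hs, .send⟩
  | recv =>
    obtain ⟨A, S, h, _⟩ := ht
    obtain ⟨hX, R, hR, hs⟩ := h.name_sess
    exact ⟨hX, R, _, hR, hs, .recv⟩
  | select =>
    obtain ⟨I, hI, S, hl, h, _⟩ := ht
    obtain ⟨hX, R, hR, hs⟩ := h.name_sess
    exact ⟨hX, R, _, hR, hs, .select hl⟩
  | caseOf =>
    obtain ⟨hI, S, U, X₁, X₂, hp, h, _⟩ := ht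
    obtain ⟨hX, R, hR, hs⟩ := h.name_sess
    exact ⟨hp.left hX, R, _, hR, hs, .caseOf⟩
  | close =>
    obtain ⟨hX, R, hR, hs⟩ := ht.1.name_sess
    exact ⟨hX, R, _, hR, hs, .close⟩
  | wait =>
    obtain ⟨hX, R, hR, hs⟩ := ht.1.name_sess
    exact ⟨hX, R, _, hR, hs, .wait⟩

/-- The type `R₁` is not dynamic, so `S` has its head constructor, and then `S.dual` fixes that of
`R₂`, hence the operation in `f`. For choices, width subtyping on the two sides chains the label
sets: the labels of the `⊕` type are among those of the channel, and these among the branches. -/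
theorem SubjAt.agree {e f : Expr} {c d : ℕ} {S R₁ R₂ : STy} (he : SubjAt e c R₁)
    (hf : SubjAt f d R₂) (h₁ : STy.Sub S R₁) (h₂ : STy.Sub S.dual R₂) : Agree c d e f := by
  cases he <;> cases h₁ <;> rw [STy.dual] at h₂ <;> cases h₂ <;> cases hf
  · exact .inl (.comm _)
  · exact .inr (.inr (.inr (.comm _)))
  · exact .inl (.choice _ (by grind))
  · exact .inr (.inr (.inr (.choice _ (by grind))))
  · exact .inl .close
  · exact .inr (.inr (.inr .close))

/-- The first two forms contradict canonical forms, the third the disjointness of parallel parts,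
the fourth duality. -/
theorem ErrorForm.not_wt {P : Proc} (h : ErrorForm P) {Γ : Name → Ty} (hΓ : NoArrowOrProd Γ)
    {X : Name → Prop} : ¬ WT P Γ X := by
  cases h with
  | app hE hv hn =>
    rintro ⟨T, ht⟩
    obtain ⟨_, _, _, _, ⟨m, A, B, _, _, _, he, _⟩, _⟩ := ht.fill_inv
    obtain hv | ⟨x, rfl⟩ := hv
    · exact hn (he.isAbstraction hv hΓ)
    · exact hΓ.not_sub_arrow he.1
  | letPair hE hv hn =>
    rintro ⟨T, ht⟩
    obtain ⟨_, _, _, _, ⟨m, A, B, _, _, _, _, he, _⟩, _⟩ := ht.fill_inv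
    obtain hv | ⟨x, rfl⟩ := hv
    · exact hn (he.isPair hv hΓ)
    · exact hΓ.not_sub_prod he.1
  | share hE hF he hf =>
    rintro ⟨X₁, X₂, hp, ⟨T₁, ht₁⟩, ⟨T₂, ht₂⟩⟩
    obtain ⟨_, _, _, hA, he', _⟩ := ht₁.fill_inv
    obtain ⟨_, _, _, hB, hf', _⟩ := ht₂.fill_inv
    exact (hp _).2.2 ⟨hA.right (he'.subjAt he).1, hB.right (hf'.subjAt hf).1⟩
  | disagree hE hF he hf hn =>
    rintro ⟨S, X₁, X₂, hp, ⟨T₁, ht₁⟩, ⟨T₂, ht₂⟩⟩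
    obtain ⟨_, _, _, _, he', _⟩ := ht₁.fill_inv
    obtain ⟨_, _, _, _, hf', _⟩ := ht₂.fill_inv
    obtain ⟨_, R, R', hR, hs, h₁⟩ := he'.subjAt he
    obtain ⟨_, V, V', hV, hs', h₂⟩ := hf'.subjAt hf
    -- The types of the endpoints `0` and `1` are by computation `S` and `S.dual`.
    cases hR
    cases hV
    exact hn (h₁.agree h₂ hs hs')

-- From immediate errors to all reducts

/-- On the way down to a subprocess the environment grows only by session types and the dynamic
type, so canonical forms remain available. -/
theorem Proc.Contains.exists_wt {P Q : Proc} (h : Proc.Contains P Q) : ∀ {Γ X}, WT P Γ X →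
    NoArrowOrProd Γ → ∃ Γ' X', WT Q Γ' X' ∧ NoArrowOrProd Γ' := by
  induction h with
  | refl => intro Γ X h hΓ; exact ⟨Γ, X, h, hΓ⟩
  | parL _ ih => rintro Γ X ⟨_, _, _, h, _⟩ hΓ; exact ih h hΓ
  | parR _ ih => rintro Γ X ⟨_, _, _, _, h⟩ hΓ; exact ih h hΓ
  | nuChan _ ih =>
    rintro Γ X ⟨S, h⟩ hΓ
    exact ih h (forall_pushChan.2 ⟨by simp, by simp, fun z => by simpa using hΓ z⟩)
  | nuRef _ ih =>
    intro Γ X h hΓ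
    exact ih (Γ := pushRef Γ .dyn) h (forall_pushRef.2 ⟨by simp, fun z => by simpa using hΓ z⟩)

theorem WT.not_isError {P : Proc} {Γ X} (h : WT P Γ X) (hΓ : NoArrowOrProd Γ) : ¬ P.IsError := by
  rintro ⟨P', Q, hc, hQ, he⟩
  obtain ⟨Γ', X', hw, hΓ'⟩ := hQ.exists_wt (hc.wt_iff.1 h) hΓ
  exact he.not_wt hΓ' hw

theorem WT.steps {P Q : Proc} (h : Proc.Steps P Q) {Γ X} (ht : WT P Γ X) : WT Q Γ X := by
  induction h with
  | refl => exact ht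
  | tail _ hs ih => exact hs.preserves ih

/-- The total environment that extends `Γ` by the type `1`. -/
def Env.total (Γ : Env) : Name → Ty := fun z => (Γ z).getD .unit

theorem Env.extends_total (Γ : Env) : Γ.Extends Γ.total := fun z T hz => by simp [Env.total, hz]

theorem Env.NoArrowOrProd.total {Γ : Env} (h : Γ.NoArrowOrProd) : GGV.NoArrowOrProd Γ.total := by
  intro z
  unfold Env.total
  cases hz : Γ z with
  -- The default type `1` is neither a function type nor a pair type.
  | none => simp
  | some T => exact h z T hz

end GGV

theorem mainTheorem2 (Γ : GGV.Env) (P Q : GGV.Proc)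
    (hP : GGV.Proc.WellTyped Γ P)
    (hΓ : Γ.NoArrowOrProd)
    (hcasts : P.CastsWellFormed)
    (hPQ : GGV.Proc.Steps P Q) :
    ¬ Q.IsError :=
  ((hP.wt hcasts Γ.extends_total).steps hPQ).not_isError hΓ.total
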